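/- Let $d\ge 2$, $N\ge 1$, let $A_1,\dots,A_d\in\mathcal M_N(\mathbb R)$ with $A_d$ invertible, and for $(\tau,\eta,\xi)\in\mathbb R\times\mathbb R^{d-1}\times\mathbb R$ put $L(\tau,\eta,\xi)=\tau I+\sum_{i=1}^{d-1}\eta_iA_i+\xi A_d$. Assume: (strict hyperbolicity) there are real functions $\tau_1<\dots<\tau_N$, real analytic on $\mathbb R^d\setminus\{0\}$, with $\det L(\tau,\eta,\xi)=\prod_{k=1}^N(\tau-\tau_k(\eta,\xi))$ for all $\tau\in\mathbb R$ and $(\eta,\xi)\ne0$; (glancing points) for all $k$ and $(\eta,\xi)\neq 0$, $\partial_\xi\tau_k(\eta,\xi)=0$ implies $\partial_\xi^2\tau_k(\eta,\xi)\ne0$. For $\sigma\in\mathbb C$, $\eta\in\mathbb R^{d-1}$ let $\mathcal A(\sigma,\eta)=-iA_d^{-1}\big(\sigma I+\sum_{i=1}^{d-1}\eta_iA_i\big)$. For $\sigma=\tau-i\gamma$ with $\gamma>0$ let $E_-(\sigma,\eta)\subset\mathbb C^N$ be the sum of the generalized eigenspaces of $\mathcal A(\sigma,\eta)$ for the eigenvalues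 of negative real part. For $\zeta=(\tau,\eta)\in\Xi_0:=(\mathbb R\times\mathbb R^{d-1})\setminus\{0\}$ let $E_-(\zeta)$ be the limit of $E_-(\zeta')$ as $\zeta'\to\zeta$ with $\gamma'>0$ (the set of $v\in\mathbb C^N$ whose distance to $E_-(\zeta')$ tends to $0$). For $\zeta=(\tau,\eta)\in\Xi_0$ write $i\xi_j$ for the distinct eigenvalues of $\mathcal A(\zeta)$. If $\xi_j$ is real there is a unique $k$ with $\tau=\tau_k(\eta,\xi_j)$, and $j$ is called glancing, $j\in\mathcal G(\zeta)$, if $\partial_\xi\tau_k(\eta,\xi_j)=0$, and incoming, $j\in\mathcal I(\zeta)$, if $\partial_\xi\tau_k(\eta,\xi_j)<0$. Let $\mathcal P(\zeta)$ be the set of $j$ with $\operatorname{Im}\xi_j>0$. Let $E_-^j(\zeta)$ be: the generalized eigenspace of $\mathcal A(\zeta)$ for $i\xi_j$ if $j\in\mathcal P(\zeta)$; $\ker L(\tau,\eta,\xi_j)\subset\mathbb C^N$ if $j\in\mathcal I(\zeta)$; $\ker(\mathcal A(\zeta)-i\xi_jI)^{\mu_j}$ if $j\in\mathcal G(\zeta)$,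 where $\mu_j$ is the number (with multiplicity) of eigenvalues of negative real part among those into which $i\xi_j$ splits for $\mathcal A(\tau-i\gamma,\eta)$ with small $\gamma>0$. Then, for every $\zeta\in\Xi_0$, $\dim E_-(\zeta')=\dim E_-(\zeta)$ for all $\zeta'$ near $\zeta$ with $\gamma'>0$, and $$E_-(\zeta)=\bigoplus_{j\in\mathcal G(\zeta)}E_-^j(\zeta)\oplus\bigoplus_{j\in\mathcal I(\zeta)}E_-^j(\zeta)\oplus\bigoplus_{j\in\mathcal P(\zeta)}E_-^j(\zeta).$$ Let $\Pi_-^j(\zeta)$, $j\in\mathcal G(\zeta)\cup\mathcal I(\zeta)$, and $\Pi_-^e(\zeta)$ be the projections of $E_-(\zeta)$ onto $E_-^j(\zeta)$ and onto $\bigoplus_{j\in\mathcal P(\zeta)}E_-^j(\zeta)$ according to this decomposition. There is a constant $C$ such that $\|\Pi_-^j(\zeta)\|\le C$ and $\|\Pi_-^e(\zeta)\|\le C$ for all $\zeta\in\Xi_0$ and all $j\in\mathcal G(\zeta)\cup\mathcal I(\zeta)$. -/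

import Mathlib

open Filter Topology

namespace HypBVP

/-! Throughout, `A 0, …, A (n-1)` are the tangential coefficient matrices `A₁(0), …, A_{d-1}(0)`,
`A (Fin.last n)` is the normal one `A_d(0)`, and the space dimension is `d = n + 1`. -/

/-- The state space `ℂ^N` with its Hermitian norm. -/
abbrev State (N : ℕ) : Type := EuclideanSpace ℂ (Fin N)

/-- The real symbol `L(0, (t, η, ξ)) = t I + ∑ᵢ ηᵢ Aᵢ + ξ A_d`. -/
noncomputable def symbol {n N : ℕ} (A : Fin (n + 1) → Matrix (Fin N) (Fin N) ℝ)
    (t : ℝ) (η : Fin n → ℝ) (ξ : ℝ) : Matrix (Fin N) (Fin N) ℝ :=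
  t • (1 : Matrix (Fin N) (Fin N) ℝ) + ∑ i : Fin n, η i • A i.castSucc + ξ • A (Fin.last n)

/-- Strict hyperbolicity with characteristic roots `τ₁ < ⋯ < τ_N`, real analytic functions of
`(η, ξ) ≠ 0`. -/
structure StrictlyHyperbolic {n N : ℕ} (A : Fin (n + 1) → Matrix (Fin N) (Fin N) ℝ)
    (τ : Fin N → (Fin n → ℝ) × ℝ → ℝ) : Prop where
  analytic : ∀ k, AnalyticOnNhd ℝ (τ k) {0}ᶜ
  strictMono : ∀ p : (Fin n → ℝ) × ℝ, p ≠ 0 → StrictMono fun k => τ k p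
  factorization : ∀ p : (Fin n → ℝ) × ℝ, p ≠ 0 → ∀ t : ℝ,
    (symbol A t p.1 p.2).det = ∏ k, (t - τ k p)

/-- The normal derivative `∂_ξ τ_k (η, ξ)`. -/
noncomputable def normalDeriv {n N : ℕ} (τ : Fin N → (Fin n → ℝ) × ℝ → ℝ) (k : Fin N)
    (η : Fin n → ℝ) (ξ : ℝ) : ℝ :=
  deriv (fun x : ℝ => τ k (η, x)) ξ

/-- The second normal derivative `∂²_ξ τ_k (η, ξ)`. -/
noncomputable def normalDeriv₂ {n N : ℕ} (τ : Fin N → (Fin n → ℝ) × ℝ → ℝ) (k : Fin N)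
    (η : Fin n → ℝ) (ξ : ℝ) : ℝ :=
  iteratedDeriv 2 (fun x : ℝ => τ k (η, x)) ξ

/-- The matrix `𝒜(σ, η) = -i A_d⁻¹ (σ I + ∑ᵢ ηᵢ Aᵢ)`, for complex `σ`. -/
noncomputable def bdryMatrix {n N : ℕ} (A : Fin (n + 1) → Matrix (Fin N) (Fin N) ℝ)
    (σ : ℂ) (η : Fin n → ℝ) : Matrix (Fin N) (Fin N) ℂ :=
  (-Complex.I) • (((A (Fin.last n)).map Complex.ofReal)⁻¹ *
    (σ • (1 : Matrix (Fin N) (Fin N) ℂ) +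
      ∑ i : Fin n, (η i : ℂ) • (A i.castSucc).map Complex.ofReal))

/-- `𝒜(σ, η)` as an endomorphism of `ℂ^N`. -/
noncomputable def bdryOp {n N : ℕ} (A : Fin (n + 1) → Matrix (Fin N) (Fin N) ℝ)
    (σ : ℂ) (η : Fin n → ℝ) : Module.End ℂ (State N) :=
  Matrix.toEuclideanLin (bdryMatrix A σ η)

/-- The sum of the generalized eigenspaces of `𝒜(σ, η)` for the eigenvalues of negative real part:
this is `E_-(σ, η)` when `σ = τ - iγ` with `γ > 0`. -/
noncomputable def stableSubspace {n N : ℕ} (A : Fin (n + 1) → Matrix (Fin N) (Fin N) ℝ)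
    (σ : ℂ) (η : Fin n → ℝ) : Submodule ℂ (State N) :=
  ⨆ z : {z : ℂ // z.re < 0}, (bdryOp A σ η).maxGenEigenspace z

/-- The filter of complex frequencies `(τ' - iγ', η')` with `γ' > 0` that tend to the real
frequency `ζ = (τ, η)`. -/
noncomputable def approach {n : ℕ} (ζ : ℝ × (Fin n → ℝ)) : Filter (ℂ × (Fin n → ℝ)) :=
  𝓝[{w | w.1.im < 0}] ((ζ.1 : ℂ), ζ.2)

/-- The stable subspace `E_-(ζ)` at a real frequency `ζ`: the limit of the stable subspaces
`E_-(ζ')` as `ζ' → ζ` with `γ' > 0`. It consists of the vectors whose distance to `E_-(ζ')` tends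
to `0`, that is, which are the limit of their orthogonal projections on `E_-(ζ')`. -/
noncomputable def Eminus {n N : ℕ} (A : Fin (n + 1) → Matrix (Fin N) (Fin N) ℝ)
    (ζ : ℝ × (Fin n → ℝ)) : Submodule ℂ (State N) where
  carrier := {v | Tendsto (fun w => (stableSubspace A w.1 w.2).starProjection v)
    (approach ζ) (𝓝 v)}
  zero_mem' := by
    simpa using tendsto_const_nhds
  add_mem' := by
    intro v w hv hw
    simpa only [Set.mem_ofPred_eq, map_add] using Tendsto.add hv hw
  smul_mem' := by
    intro c v hv
    simpa only [Set.mem_ofPred_eq, map_smul] using Tendsto.const_smul hv c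

/-- The distinct eigenvalues of `𝒜(ζ)` are written `iξ`; the numbers `ξ` index the spectrum. -/
def phases {n N : ℕ} (A : Fin (n + 1) → Matrix (Fin N) (Fin N) ℝ)
    (ζ : ℝ × (Fin n → ℝ)) : Set ℂ :=
  {ξ | (bdryOp A ζ.1 ζ.2).HasEigenvalue (Complex.I * ξ)}

/-- `𝒢(ζ)`: real `ξ` for which the characteristic frequency `(ζ, ξ)` is glancing. -/
def glancing {n N : ℕ} (A : Fin (n + 1) → Matrix (Fin N) (Fin N) ℝ)
    (τ : Fin N → (Fin n → ℝ) × ℝ → ℝ) (ζ : ℝ × (Fin n → ℝ)) : Set ℂ :=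
  {ξ | ξ ∈ phases A ζ ∧ ξ.im = 0 ∧
    ∃ k, ζ.1 = τ k (ζ.2, ξ.re) ∧ normalDeriv τ k ζ.2 ξ.re = 0}

/-- `ℐ(ζ)`: real `ξ` for which the characteristic frequency `(ζ, ξ)` is incoming. -/
def incoming {n N : ℕ} (A : Fin (n + 1) → Matrix (Fin N) (Fin N) ℝ)
    (τ : Fin N → (Fin n → ℝ) × ℝ → ℝ) (ζ : ℝ × (Fin n → ℝ)) : Set ℂ :=
  {ξ | ξ ∈ phases A ζ ∧ ξ.im = 0 ∧
    ∃ k, ζ.1 = τ k (ζ.2, ξ.re) ∧ normalDeriv τ k ζ.2 ξ.re < 0}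

/-- `𝒫(ζ)`: the `ξ` with positive imaginary part. -/
def elliptic {n N : ℕ} (A : Fin (n + 1) → Matrix (Fin N) (Fin N) ℝ)
    (ζ : ℝ × (Fin n → ℝ)) : Set ℂ :=
  {ξ | ξ ∈ phases A ζ ∧ 0 < ξ.im}

open Classical in
/-- The number, with algebraic multiplicity, of eigenvalues of `𝒜(τ - iγ, η)` of negative real
part at distance less than `ε` from `iξ`. -/
noncomputable def stableCount {n N : ℕ} (A : Fin (n + 1) → Matrix (Fin N) (Fin N) ℝ)
    (ζ : ℝ × (Fin n → ℝ)) (ξ : ℂ) (ε γ : ℝ) : ℕ :=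
  Multiset.card ((bdryMatrix A (ζ.1 - Complex.I * γ) ζ.2).charpoly.roots.filter
    fun z => z.re < 0 ∧ dist z (Complex.I * ξ) < ε)

/-- The number `μ` of eigenvalues of negative real part among those into which the eigenvalue `iξ`
of `𝒜(τ, η)` splits for `𝒜(τ - iγ, η)` with small `γ > 0`. At most one `m` has the
property below. -/
noncomputable def stableIndex {n N : ℕ} (A : Fin (n + 1) → Matrix (Fin N) (Fin N) ℝ)
    (ζ : ℝ × (Fin n → ℝ)) (ξ : ℂ) : ℕ :=
  sInf {m : ℕ | ∀ᶠ ε : ℝ in 𝓝[>] 0, ∀ᶠ γ : ℝ in 𝓝[>] 0, stableCount A ζ ξ ε γ = m}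

open Classical in
/-- The component `E_-^j(ζ)` for the eigenvalue `iξ = iξ_j(ζ)`: the generalized eigenspace if
`ξ ∈ 𝒫(ζ)`, the kernel of `L(0, (ζ, ξ))` in `ℂ^N` if `ξ ∈ ℐ(ζ)`, and the kernel of
`(𝒜(ζ) - iξ)^μ` if `ξ ∈ 𝒢(ζ)`. -/
noncomputable def component {n N : ℕ} (A : Fin (n + 1) → Matrix (Fin N) (Fin N) ℝ)
    (τ : Fin N → (Fin n → ℝ) × ℝ → ℝ) (ζ : ℝ × (Fin n → ℝ)) (ξ : ℂ) :
    Submodule ℂ (State N) :=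
  if ξ ∈ elliptic A ζ then
    (bdryOp A ζ.1 ζ.2).maxGenEigenspace (Complex.I * ξ)
  else if ξ ∈ incoming A τ ζ then
    LinearMap.ker (Matrix.toEuclideanLin ((symbol A ζ.1 ζ.2 ξ.re).map Complex.ofReal))
  else if ξ ∈ glancing A τ ζ then
    LinearMap.ker ((bdryOp A ζ.1 ζ.2 - algebraMap ℂ (Module.End ℂ (State N)) (Complex.I * ξ)) ^
      stableIndex A ζ ξ)
  else ⊥

/-- The index set `𝒢(ζ) ∪ ℐ(ζ) ∪ 𝒫(ζ)` of the decomposition of `E_-(ζ)`. -/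
def stablePhases {n N : ℕ} (A : Fin (n + 1) → Matrix (Fin N) (Fin N) ℝ)
    (τ : Fin N → (Fin n → ℝ) × ℝ → ℝ) (ζ : ℝ × (Fin n → ℝ)) : Set ℂ :=
  glancing A τ ζ ∪ incoming A τ ζ ∪ elliptic A ζ

open Classical in
/-- For subspaces with `E = F ⊕ K`, the projection from `E` onto `F` along `K`, as a continuous
linear map `E → ℂ^N` (and `0` if `E` is not the direct sum of its intersections with `F`, `K`). -/
noncomputable def projAlong {N : ℕ} (E F K : Submodule ℂ (State N)) : E →L[ℂ] State N :=
  if h : IsCompl (F.comap E.subtype) (K.comap E.subtype) then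
    LinearMap.toContinuousLinearMap (E.subtype ∘ₗ Submodule.projection _ _ h)
  else 0

/-- The projector `Π^j_-(ζ)` of `E_-(ζ)` on the component of `ξ = ξ_j(ζ)`, along the sum of the
other components. -/
noncomputable def projComponent {n N : ℕ} (A : Fin (n + 1) → Matrix (Fin N) (Fin N) ℝ)
    (τ : Fin N → (Fin n → ℝ) × ℝ → ℝ) (ζ : ℝ × (Fin n → ℝ)) (ξ : ℂ) :
    Eminus A ζ →L[ℂ] State N :=
  projAlong (Eminus A ζ) (component A τ ζ ξ)
    (⨆ ξ' ∈ stablePhases A τ ζ \ {ξ}, component A τ ζ ξ')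

/-- The projector `Π^e_-(ζ)` of `E_-(ζ)` on its elliptic part, along the sum of the glancing and
incoming components. -/
noncomputable def projElliptic {n N : ℕ} (A : Fin (n + 1) → Matrix (Fin N) (Fin N) ℝ)
    (τ : Fin N → (Fin n → ℝ) × ℝ → ℝ) (ζ : ℝ × (Fin n → ℝ)) :
    Eminus A ζ →L[ℂ] State N :=
  projAlong (Eminus A ζ) (⨆ ξ ∈ elliptic A ζ, component A τ ζ ξ)
    (⨆ ξ ∈ glancing A τ ζ ∪ incoming A τ ζ, component A τ ζ ξ)

end HypBVP

/-!
The eigenvalues of `𝒜(σ, η)` are `iξ` for the roots `ξ` of `P(σ, η, ·)`, where `P = det L` is a real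
polynomial. The whole argument takes place at the level of `P` and of its roots; neither spectral
integrals nor holomorphic extensions of the `τ_k` are needed.

*Counting stable roots.* Let `ξ` be a real root of `P(τ, η, ·)` at a real frequency. As
`τ = τ_k(η, ξ)` for exactly one `k`, one has `∂_σ P ≠ 0` and `∂_ξ P = -∂_ξ τ_k ∂_σ P`, and at a
glancing point `∂²_ξ P = -∂²_ξ τ_k ∂_σ P ≠ 0` (`derivatives_at_real_root`). So `ξ` is glancing or
incoming if and only if `∂_σ P ∂_ξ P ≥ 0`, and it is a root of multiplicity at most two. For
`Im σ < 0`, the mean value theorem for `Im P` between a point and its real part shows that a simple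
root moves into the upper half plane if and only if it is incoming
(`eventually_im_pos_iff_of_simple`), and that exactly one of the two roots near a glancing point
does (`exists_nhds_im_pos_iff_of_double`). In the end a glancing or incoming phase attracts exactly
one stable root, an outgoing phase none (`RootLimit.card_real_phase`).

*The limit of the stable subspaces.* The roots are followed along ultrafilters, on which they
converge by compactness while the set `S` of the stable ones is constant. The stable subspace has
dimension `|S|` and is annihilated by `∏_{i ∈ S} (𝒜 - rᵢ)`, so that a limit of the orthogonal
projections has rank `|S|` and a range contained in the kernel of the limit of this product. That
kernel is contained in the sum of the components, whose dimension is `|S|` as well by the count of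
the roots and because real eigenvalues are geometrically simple (`finrank_ker_real_phase`,
`card_eq_finrank_component`). Hence `E_-` is the sum of the components
(`iSup_component_eq_Eminus`).

*Uniform bounds.* Since the count near a real phase of `ζ₀` is at most one, the frequencies close to
`ζ₀` have at most one stable phase there (`exists_stablePhases_unique`). So, as `ζ → ζ₀`, a glancing
or incoming component, or the elliptic part, and the sum of the remaining components are annihilated
by products of characteristic factors over two sets of roots without common limits. The limits of
the two products are coprime, and a common limit of unit vectors of the two subspaces would be in
both kernels (`exists_bound_on_sphere`). By homogeneity the compact unit sphere of frequencies
suffices.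
-/

namespace HypBVP

/-! ### Linear algebra of one endomorphism -/

section LinearAlgebra

open Polynomial Module

variable {K V : Type*} [Field K] [AddCommGroup V] [Module K V]

/-- A factor of an annihilating polynomial that does not vanish at `z` is not needed to annihilate
the generalized eigenspace of `z`. -/
lemma maxGenEigenspace_le_ker_aeval (T : End K V) {p q : K[X]} (h : aeval T (p * q) = 0)
    {z : K} (hz : ¬ p.IsRoot z) : T.maxGenEigenspace z ≤ LinearMap.ker (aeval T q) := by
  intro v hv
  obtain ⟨k, hk⟩ := (End.mem_maxGenEigenspace T z v).1 hv
  have hcop : IsCoprime ((X - C z) ^ k) p :=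
    IsCoprime.pow_left (((irreducible_X_sub_C z).coprime_iff_not_dvd).2
      fun hd => hz (dvd_iff_isRoot.1 hd))
  have hdis := disjoint_ker_aeval_of_isCoprime T hcop
  have h1 : aeval T q v ∈ LinearMap.ker (aeval T ((X - C z) ^ k)) := by
    have : aeval T ((X - C z) ^ k) v = 0 := by
      simpa [Algebra.algebraMap_eq_smul_one] using hk
    rw [LinearMap.mem_ker, ← Module.End.mul_apply, ← map_mul, mul_comm, map_mul,
      Module.End.mul_apply, this, map_zero]
  have h2 : aeval T q v ∈ LinearMap.ker (aeval T p) := by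
    rw [LinearMap.mem_ker, ← Module.End.mul_apply, ← map_mul, h, LinearMap.zero_apply]
  exact (Submodule.mem_bot K).1 (hdis.le_bot ⟨h1, h2⟩)

lemma finrank_biSup_eq_sum [FiniteDimensional K V] {ι : Type*} (E : ι → Submodule K V)
    (h : iSupIndep E) (s : Finset ι) :
    finrank K (⨆ i ∈ s, E i : Submodule K V) = ∑ i ∈ s, finrank K (E i) := by
  classical
  induction s using Finset.induction_on with
  | empty => simp
  | insert a s ha ih =>
    have hd : Disjoint (E a) (⨆ i ∈ s, E i) :=
      (h a).mono_right (iSup₂_le fun i hi => le_iSup₂_of_le i (by rintro rfl; exact ha hi) le_rfl)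
    rw [Finset.iSup_insert, Finset.sum_insert ha, ← ih,
      ← Submodule.finrank_sup_add_finrank_inf_eq, hd.eq_bot, finrank_bot, add_zero]

lemma ker_aeval_prod_le (T : End K V) (s : Finset K) (m : K → ℕ) :
    LinearMap.ker (aeval T (∏ z ∈ s, (X - C z) ^ m z)) ≤
      ⨆ z ∈ s, LinearMap.ker (aeval T ((X - C z) ^ m z)) := by
  classical
  induction s using Finset.induction_on with
  | empty => simp [Module.End.one_eq_id]
  | insert a s ha ih =>
    have hcop : IsCoprime ((X - C a) ^ m a) (∏ z ∈ s, (X - C z) ^ m z) := by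
      refine IsCoprime.prod_right fun z hz => IsCoprime.pow ?_
      exact isCoprime_X_sub_C_of_isUnit_sub
        (sub_ne_zero.2 (by rintro rfl; exact ha hz)).isUnit
    rw [Finset.prod_insert ha, Finset.iSup_insert,
      ← sup_ker_aeval_eq_ker_aeval_mul_of_coprime T hcop]
    exact sup_le_sup_left ih _

lemma ker_aeval_X_sub_C_pow (T : End K V) (z : K) (m : ℕ) :
    LinearMap.ker (aeval T ((X - C z) ^ m)) =
      LinearMap.ker ((T - algebraMap K (End K V) z) ^ m) := by
  simp

lemma rootMultiplicity_prod_X_sub_C {ι : Type*} [Fintype ι] [DecidableEq K] (r : ι → K) (z : K) :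
    (∏ i, (X - C (r i))).rootMultiplicity z = (Finset.univ.filter fun i => r i = z).card := by
  have h : (∏ i, (X - C (r i))).roots = Finset.univ.val.map r := by
    have := roots_multiset_prod_X_sub_C (Finset.univ.val.map r)
    simpa [Multiset.map_map, Function.comp_def] using this
  rw [← count_roots, h, Multiset.count_map, ← Finset.filter_val, Finset.card_val]
  congr 1
  ext i
  simp [eq_comm]

lemma roots_prod_X_sub_C_univ {ι : Type*} [Fintype ι] (r : ι → K) :
    (∏ i, (X - C (r i))).roots = Finset.univ.val.map r := by
  have := roots_multiset_prod_X_sub_C (Finset.univ.val.map r)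
  simpa [Multiset.map_map, Function.comp_def] using this

variable [FiniteDimensional K V]

lemma maxGenEigenspace_eq_bot_of_not_root {T : End K V} {z : K} (h : ¬ T.charpoly.IsRoot z) :
    T.maxGenEigenspace z = ⊥ := by
  rw [← Submodule.finrank_eq_zero (R := K), LinearMap.finrank_maxGenEigenspace_eq,
    rootMultiplicity_eq_zero h]

/-- The sum of the generalized eigenspaces for the eigenvalues with property `p` has as dimension
the number of characteristic roots with that property. -/
lemma finrank_iSup_maxGenEigenspace {ι : Type*} [Fintype ι] {T : End K V} {r : ι → K}
    (hr : T.charpoly = ∏ i, (X - C (r i))) (p : K → Prop) [DecidablePred p] :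
    finrank K (⨆ z : {z : K // p z}, T.maxGenEigenspace z : Submodule K V) =
      (Finset.univ.filter fun i => p (r i)).card := by
  classical
  have h1 : (⨆ z : {z : K // p z}, T.maxGenEigenspace z : Submodule K V) =
      ⨆ z ∈ (Finset.univ.image r).filter p, T.maxGenEigenspace z := by
    apply le_antisymm
    · refine iSup_le fun z => ?_
      by_cases hz : T.charpoly.IsRoot z.1
      · refine le_iSup₂_of_le z.1 ?_ le_rfl
        rw [hr, IsRoot, eval_prod, Finset.prod_eq_zero_iff] at hz
        obtain ⟨i, _, hi⟩ := hz
        simp only [eval_sub, eval_X, eval_C, sub_eq_zero] at hi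
        simpa [z.2] using ⟨i, hi.symm⟩
      · rw [maxGenEigenspace_eq_bot_of_not_root hz]
        exact bot_le
    · refine iSup₂_le fun z hz => ?_
      exact le_iSup (fun z : {z : K // p z} => T.maxGenEigenspace z)
        ⟨z, (Finset.mem_filter.1 hz).2⟩
  rw [h1, finrank_biSup_eq_sum _ T.independent_maxGenEigenspace]
  simp_rw [LinearMap.finrank_maxGenEigenspace_eq, hr, rootMultiplicity_prod_X_sub_C]
  rw [Finset.card_eq_sum_card_fiberwise (f := r) (t := (Finset.univ.image r).filter p)]
  · refine Finset.sum_congr rfl fun z hz => ?_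
    congr 1
    ext i
    simp only [Finset.mem_filter, Finset.mem_univ, true_and]
    constructor
    · rintro rfl
      exact ⟨(Finset.mem_filter.1 hz).2, rfl⟩
    · exact fun h => h.2
  · intro i hi
    simpa using hi

/-- Generalized eigenvectors are annihilated by any product of characteristic factors that contains
all the occurrences of their eigenvalues. -/
lemma maxGenEigenspace_le_ker_aeval_prod {ι : Type*} [Fintype ι] {T : End K V} {r : ι → K}
    (hr : T.charpoly = ∏ i, (X - C (r i))) (s : Finset ι) {z : K} (hz : ∀ i, r i = z → i ∈ s) :
    T.maxGenEigenspace z ≤ LinearMap.ker (aeval T (∏ i ∈ s, (X - C (r i)))) := by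
  classical
  apply maxGenEigenspace_le_ker_aeval T (p := ∏ i ∈ sᶜ, (X - C (r i)))
  · rw [Finset.prod_compl_mul_prod, ← hr, LinearMap.aeval_self_charpoly]
  · rw [IsRoot, eval_prod, Finset.prod_eq_zero_iff]
    rintro ⟨i, hi, h⟩
    simp only [eval_sub, eval_X, eval_C, sub_eq_zero] at h
    exact Finset.mem_compl.1 hi (hz i h.symm)

end LinearAlgebra

/-! ### Convergence of characteristic roots along ultrafilters -/

section Roots

open Polynomial

variable {N : ℕ}

/-- A complex square matrix as a continuous operator on the Hermitian space of states. -/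
noncomputable def opCLM (M : Matrix (Fin N) (Fin N) ℂ) : State N →L[ℂ] State N :=
  Matrix.toEuclideanCLM (n := Fin N) (𝕜 := ℂ) M

lemma coe_opCLM (M : Matrix (Fin N) (Fin N) ℂ) :
    (opCLM M : State N →ₗ[ℂ] State N) = Matrix.toEuclideanLin M :=
  Matrix.coe_toEuclideanCLM_eq_toEuclideanLin M

lemma continuous_opCLM : Continuous (opCLM : Matrix (Fin N) (Fin N) ℂ → _) :=
  LinearMap.continuous_of_finiteDimensional
    ((Matrix.toEuclideanCLM (n := Fin N) (𝕜 := ℂ)).toAlgEquiv.toLinearMap)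

lemma charpoly_toEuclideanLin (M : Matrix (Fin N) (Fin N) ℂ) :
    (Matrix.toEuclideanLin M).charpoly = M.charpoly := by
  rw [show Matrix.toEuclideanLin M = Matrix.toLin _ _ M from
    congrArg (fun f => f M) (Matrix.toLpLin_eq_toLin 2 2), Matrix.charpoly_toLin]

lemma exists_charpoly_eq_prod (M : Matrix (Fin N) (Fin N) ℂ) :
    ∃ r : Fin N → ℂ, M.charpoly = ∏ i, (X - C (r i)) := by
  have hs := IsAlgClosed.splits M.charpoly
  have hcard : M.charpoly.roots.toList.length = N := by
    rw [Multiset.length_toList, ← hs.natDegree_eq_card_roots, Matrix.charpoly_natDegree_eq_dim,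
      Fintype.card_fin]
  refine ⟨fun i => M.charpoly.roots.toList.get (i.cast hcard.symm), ?_⟩
  have h1 := hs.eq_prod_roots_of_monic M.charpoly_monic
  have h2 : (M.charpoly.roots.map fun a => X - C a).prod =
      ((M.charpoly.roots.toList.map fun a => X - C a)).prod := by
    rw [← Multiset.prod_coe, ← Multiset.map_coe, Multiset.coe_toList]
  conv_lhs => rw [h1, h2]
  rw [← List.prod_ofFn]
  congr 1
  apply List.ext_get <;> simp [hcard]

lemma norm_root_le {M : Matrix (Fin N) (Fin N) ℂ} {z : ℂ} (hz : M.charpoly.IsRoot z) :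
    ‖z‖ ≤ ‖opCLM M‖ := by
  rw [← charpoly_toEuclideanLin, ← Module.End.hasEigenvalue_iff_isRoot_charpoly] at hz
  obtain ⟨v, hv⟩ := hz.exists_hasEigenvector
  have h1 : opCLM M v = z • v := by
    have := hv.apply_eq_smul
    rwa [← coe_opCLM] at this
  have h2 := (opCLM M).le_opNorm v
  rw [h1, norm_smul] at h2
  exact le_of_mul_le_mul_right h2 (norm_pos_iff.2 hv.2)

/-- Characteristic roots depend continuously on the matrix: along an ultrafilter, any enumeration
of them converges to an enumeration of the roots of the limit. -/
lemma exists_tendsto_roots {W : Type*} (U : Ultrafilter W) {M : W → Matrix (Fin N) (Fin N) ℂ}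
    {M₀ : Matrix (Fin N) (Fin N) ℂ} (hM : Tendsto M U (𝓝 M₀)) {r : W → Fin N → ℂ}
    (hr : ∀ w, (M w).charpoly = ∏ i, (X - C (r w i))) :
    ∃ r₀ : Fin N → ℂ, Tendsto r U (𝓝 r₀) ∧ M₀.charpoly = ∏ i, (X - C (r₀ i)) := by
  have hb : ∀ᶠ w in (U : Filter W), r w ∈ Metric.closedBall (0 : Fin N → ℂ) (‖opCLM M₀‖ + 1) := by
    have h1 := ((continuous_norm.comp continuous_opCLM).tendsto M₀).comp hM
    filter_upwards [h1.eventually (gt_mem_nhds (lt_add_one ‖opCLM M₀‖))] with w hw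
    rw [mem_closedBall_zero_iff, pi_norm_le_iff_of_nonneg (by positivity)]
    intro i
    refine (norm_root_le (M := M w) ?_).trans hw.le
    rw [hr w, IsRoot, eval_prod]
    exact Finset.prod_eq_zero (Finset.mem_univ i) (by simp)
  obtain ⟨r₀, -, hr₀⟩ := (isCompact_closedBall (0 : Fin N → ℂ) (‖opCLM M₀‖ + 1)).ultrafilter_le_nhds
    (U.map r) (le_principal_iff.2 hb)
  have hr₀' : Tendsto r U (𝓝 r₀) := hr₀
  refine ⟨r₀, hr₀', Polynomial.funext fun z => ?_⟩
  have h1 : Tendsto (fun w => (M w).charpoly.eval z) U (𝓝 (M₀.charpoly.eval z)) := by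
    simp only [Matrix.eval_charpoly]
    exact ((continuous_const.sub continuous_id).matrix_det.tendsto M₀).comp hM
  have h2 : Tendsto (fun w => (M w).charpoly.eval z) U
      (𝓝 ((∏ i, (X - C (r₀ i))).eval z)) := by
    simp only [hr, eval_prod, eval_sub, eval_X, eval_C]
    exact tendsto_finsetProd _ fun i _ => tendsto_const_nhds.sub
      ((tendsto_pi_nhds.1 hr₀') i)
  exact tendsto_nhds_unique h1 h2

/-- Along an ultrafilter, the set of indices with a given property is eventually constant. -/
lemma exists_eventually_filter_eq {W ι : Type*} [Fintype ι] (U : Ultrafilter W)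
    (p : W → ι → Prop) [∀ w, DecidablePred (p w)] :
    ∃ s : Finset ι, ∀ᶠ w in (U : Filter W), (Finset.univ.filter (p w)) = s := by
  classical
  refine ⟨Finset.univ.filter fun i => ∀ᶠ w in (U : Filter W), p w i, ?_⟩
  have : ∀ᶠ w in (U : Filter W), ∀ i, (p w i ↔ ∀ᶠ w in (U : Filter W), p w i) := by
    rw [eventually_all]
    intro i
    by_cases h : ∀ᶠ w in (U : Filter W), p w i
    · filter_upwards [h] with w hw
      simp [hw, h]
    · have h' := Ultrafilter.eventually_not.2 h
      filter_upwards [h'] with w hw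
      simp [hw, h]
  filter_upwards [this] with w hw
  ext i
  simp [hw i]

end Roots

/-! ### Real polynomials at complex frequencies -/

section Polynomials

open MvPolynomial

variable {n : ℕ}

/-- The frequency `(σ, η, ξ)` as a point of `ℂ^(n+2)`: the coordinate `none` is `σ`, the
coordinates `some i` are those of `(η, ξ)`. -/
def freq (w : ℂ × (Fin n → ℝ)) (ξ : ℂ) : Option (Fin (n + 1)) → ℂ
  | none => w.1
  | some i => Fin.lastCases (motive := fun _ => ℂ) ξ (fun j => (w.2 j : ℂ)) i

/-- The value of a real polynomial in `(σ, η, ξ)` at a frequency with complex `σ` and `ξ`. -/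
noncomputable def val (G : MvPolynomial (Option (Fin (n + 1))) ℝ) (w : ℂ × (Fin n → ℝ)) (ξ : ℂ) :
    ℂ :=
  aeval (freq w ξ) G

/-- The formal derivative `∂_σ`. -/
noncomputable def dσ (G : MvPolynomial (Option (Fin (n + 1))) ℝ) :
    MvPolynomial (Option (Fin (n + 1))) ℝ := pderiv none G

/-- The formal derivative `∂_ξ`. -/
noncomputable def dξ (G : MvPolynomial (Option (Fin (n + 1))) ℝ) :
    MvPolynomial (Option (Fin (n + 1))) ℝ := pderiv (some (Fin.last n)) G

lemma continuous_freq : Continuous fun q : (ℂ × (Fin n → ℝ)) × ℂ => freq q.1 q.2 := by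
  refine continuous_pi fun o => ?_
  cases o with
  | none => simpa [freq] using continuous_fst.fst
  | some i =>
    induction i using Fin.lastCases with
    | last => simpa [freq] using continuous_snd
    | cast j =>
      simp only [freq, Fin.lastCases_castSucc]
      fun_prop

lemma continuous_val (G : MvPolynomial (Option (Fin (n + 1))) ℝ) :
    Continuous fun q : (ℂ × (Fin n → ℝ)) × ℂ => val G q.1 q.2 := by
  induction G using MvPolynomial.induction_on with
  | C a => simpa [val] using continuous_const
  | add p q hp hq =>
    simp only [val, map_add] at hp hq ⊢
    fun_prop
  | mul_X p i hp =>
    have hi := (continuous_apply i).comp (continuous_freq (n := n))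
    simp only [val, map_mul, aeval_X, Function.comp_def] at hp hi ⊢
    fun_prop

lemma hasDerivAt_aeval_line {ι : Type*} [Fintype ι] [DecidableEq ι] (G : MvPolynomial ι ℝ)
    (v u : ι → ℂ) (t : ℂ) :
    HasDerivAt (fun t : ℂ => aeval (v + t • u) G)
      (∑ i, u i * aeval (v + t • u) (pderiv i G)) t := by
  induction G using MvPolynomial.induction_on with
  | C a => simpa using hasDerivAt_const t _
  | add p q hp hq => simpa [mul_add, Finset.sum_add_distrib] using hp.fun_add hq
  | mul_X p i hp =>
    have h1 : HasDerivAt (fun t : ℂ => v i + t * u i) (u i) t := by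
      simpa using ((hasDerivAt_id t).mul_const (u i)).const_add (v i)
    have h2 := hp.fun_mul h1
    simp only [map_mul, aeval_X, Pi.add_apply, Pi.smul_apply, smul_eq_mul]
    refine h2.congr_deriv ?_
    symm
    simp only [Derivation.leibniz, pderiv_X, smul_eq_mul, map_add, map_mul, aeval_X, Pi.add_apply,
      Pi.smul_apply, smul_eq_mul, mul_add, Finset.sum_add_distrib, Finset.sum_mul]
    rw [add_comm]
    congr 1
    · rw [← Finset.sum_add_distrib]
      exact Finset.sum_congr rfl fun j _ => by ring
    · rw [Finset.sum_eq_single i]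
      · simp; ring
      · intro j _ hj
        simp [hj]
      · simp

lemma freq_eq_ofReal_re (w : ℂ × (Fin n → ℝ)) (ξ : ℂ) (hw : w.1.im = 0) (hξ : ξ.im = 0) :
    freq w ξ = fun o => (((freq w ξ o).re : ℝ) : ℂ) := by
  funext o
  cases o with
  | none => exact Complex.ext (by simp) (by simp [freq, hw])
  | some i =>
    induction i using Fin.lastCases with
    | last => exact Complex.ext (by simp) (by simp [freq, hξ])
    | cast j => simp [freq]

lemma val_im_of_real (G : MvPolynomial (Option (Fin (n + 1))) ℝ) {w : ℂ × (Fin n → ℝ)} {ξ : ℂ}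
    (hw : w.1.im = 0) (hξ : ξ.im = 0) : (val G w ξ).im = 0 := by
  rw [val, freq_eq_ofReal_re w ξ hw hξ]
  induction G using MvPolynomial.induction_on with
  | C a => simp
  | add p q hp hq => simp [hp, hq]
  | mul_X p i hp => simp [hp]

lemma freq_add_line (w : ℂ × (Fin n → ℝ)) (ξ a b t : ℂ) :
    freq (w.1 + t * a, w.2) (ξ + t * b) =
      freq w ξ + t • (Pi.single none a + Pi.single (some (Fin.last n)) b) := by
  funext o
  cases o with
  | none => simp [freq]
  | some i =>
    induction i using Fin.lastCases with
    | last => simp [freq]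
    | cast j => simp [freq, Fin.castSucc_ne_last]

lemma hasDerivAt_val_line (G : MvPolynomial (Option (Fin (n + 1))) ℝ) (w : ℂ × (Fin n → ℝ))
    (ξ a b t : ℂ) :
    HasDerivAt (fun t : ℂ => val G (w.1 + t * a, w.2) (ξ + t * b))
      (a * val (dσ G) (w.1 + t * a, w.2) (ξ + t * b) +
        b * val (dξ G) (w.1 + t * a, w.2) (ξ + t * b)) t := by
  have h := hasDerivAt_aeval_line G (freq w ξ)
    (Pi.single none a + Pi.single (some (Fin.last n)) b) t
  simp only [← freq_add_line] at h
  refine h.congr_deriv ?_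
  rw [Fintype.sum_option, Fintype.sum_eq_single (Fin.last n)]
  · simp [val, dσ, dξ]
  · intro i hi
    simp [hi]

lemma hasDerivAt_val (G : MvPolynomial (Option (Fin (n + 1))) ℝ) (w : ℂ × (Fin n → ℝ)) (ξ : ℂ) :
    HasDerivAt (fun x : ℂ => val G w x) (val (dξ G) w ξ) ξ := by
  have h := hasDerivAt_val_line G w 0 0 1 ξ
  simpa using h

lemma hasDerivAt_val_fst (G : MvPolynomial (Option (Fin (n + 1))) ℝ) (w : ℂ × (Fin n → ℝ))
    (ξ : ℂ) : HasDerivAt (fun x : ℂ => val G (x, w.2) ξ) (val (dσ G) w ξ) w.1 := by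
  have h := hasDerivAt_val_line G (0, w.2) ξ 1 0 w.1
  simpa using h

/-- The point with the same real part and the imaginary part multiplied by `s`. -/
def shrink (s : ℝ) (z : ℂ) : ℂ := ⟨z.re, s * z.im⟩

lemma norm_shrink_sub_le {s : ℝ} (h0 : 0 ≤ s) (h1 : s ≤ 1) (z : ℂ) (x : ℝ) :
    ‖shrink s z - x‖ ≤ ‖z - x‖ := by
  rw [Complex.norm_def, Complex.norm_def]
  apply Real.sqrt_le_sqrt
  simp only [Complex.normSq_apply, shrink, Complex.sub_re, Complex.sub_im, Complex.ofReal_re,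
    Complex.ofReal_im, sub_zero]
  nlinarith [mul_nonneg (sub_nonneg.2 h1) (mul_self_nonneg z.im),
    mul_nonneg (mul_nonneg h0 (sub_nonneg.2 h1)) (mul_self_nonneg z.im)]

/-- Mean value theorem for the imaginary part of a real polynomial, between a point and its real
part. -/
lemma exists_im_val_eq (G : MvPolynomial (Option (Fin (n + 1))) ℝ) (w : ℂ × (Fin n → ℝ)) (ξ : ℂ) :
    ∃ s ∈ Set.Ioo (0 : ℝ) 1, (val G w ξ).im =
      w.1.im * (val (dσ G) (shrink s w.1, w.2) (shrink s ξ)).re +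
        ξ.im * (val (dξ G) (shrink s w.1, w.2) (shrink s ξ)).re := by
  have hsh : ∀ (s : ℝ) (z : ℂ), (z.re : ℂ) + s * (z.im * Complex.I) = shrink s z := fun s z =>
    Complex.ext (by simp [shrink]) (by simp [shrink])
  have hd : ∀ s : ℝ, HasDerivAt (fun s : ℝ => (val G (shrink s w.1, w.2) (shrink s ξ)).im)
      (w.1.im * (val (dσ G) (shrink s w.1, w.2) (shrink s ξ)).re +
        ξ.im * (val (dξ G) (shrink s w.1, w.2) (shrink s ξ)).re) s := by
    intro s
    have h := (hasDerivAt_val_line G (w.1.re, w.2) ξ.re (w.1.im * Complex.I)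
      (ξ.im * Complex.I) s).comp_ofReal
    have h' := Complex.imCLM.hasFDerivAt.comp_hasDerivAt s h
    simp only [hsh, Function.comp_def] at h'
    refine h'.congr_deriv ?_
    simp
  obtain ⟨s, hs, h⟩ := exists_hasDerivAt_eq_slope
    (fun s : ℝ => (val G (shrink s w.1, w.2) (shrink s ξ)).im) _ zero_lt_one
    (fun s _ => (hd s).continuousAt.continuousWithinAt) (fun s _ => hd s)
  refine ⟨s, hs, ?_⟩
  have h0 : (val G (shrink 0 w.1, w.2) (shrink 0 ξ)).im = 0 :=
    val_im_of_real G (by simp [shrink]) (by simp [shrink])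
  have h1 : (val G (shrink 1 w.1, w.2) (shrink 1 ξ)).im = (val G w ξ).im := by
    simp [shrink]
  rw [h, h0, h1]
  simp

/-- Near a real frequency, the imaginary part of a real polynomial is a combination of the
imaginary parts of `σ` and `ξ`, with coefficients close to the partial derivatives. -/
lemma eventually_im_val_eq (G : MvPolynomial (Option (Fin (n + 1))) ℝ) (t : ℝ) (η : Fin n → ℝ)
    (x : ℝ) {ε : ℝ} (hε : 0 < ε) :
    ∀ᶠ q : (ℂ × (Fin n → ℝ)) × ℂ in 𝓝 (((t : ℂ), η), (x : ℂ)), ∃ a b : ℝ,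
      |a - (val (dσ G) (t, η) x).re| < ε ∧ |b - (val (dξ G) (t, η) x).re| < ε ∧
        (val G q.1 q.2).im = q.1.1.im * a + q.2.im * b := by
  have hc : ∀ H : MvPolynomial (Option (Fin (n + 1))) ℝ,
      ∀ᶠ q : (ℂ × (Fin n → ℝ)) × ℂ in 𝓝 (((t : ℂ), η), (x : ℂ)),
        |(val H q.1 q.2).re - (val H (t, η) x).re| < ε := by
    intro H
    have h1 : Continuous fun q : (ℂ × (Fin n → ℝ)) × ℂ =>
        |(val H q.1 q.2).re - (val H (t, η) x).re| :=
      ((Complex.continuous_re.comp (continuous_val H)).sub continuous_const).abs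
    have h2 := h1.tendsto (((t : ℂ), η), (x : ℂ))
    simp only [sub_self, abs_zero] at h2
    exact h2.eventually (gt_mem_nhds hε)
  obtain ⟨δ, hδ, h⟩ := Metric.eventually_nhds_iff_ball.1 ((hc (dσ G)).and (hc (dξ G)))
  filter_upwards [Metric.ball_mem_nhds _ hδ] with q hq
  obtain ⟨s, hs, he⟩ := exists_im_val_eq G q.1 q.2
  have hmem : ((shrink s q.1.1, q.1.2), shrink s q.2) ∈
      Metric.ball (((t : ℂ), η), (x : ℂ)) δ := by
    simp only [Metric.mem_ball, Prod.dist_eq, max_lt_iff] at hq ⊢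
    refine ⟨⟨?_, hq.1.2⟩, ?_⟩
    · have := norm_shrink_sub_le hs.1.le hs.2.le q.1.1 t
      rw [← dist_eq_norm, ← dist_eq_norm] at this
      exact this.trans_lt hq.1.1
    · have := norm_shrink_sub_le hs.1.le hs.2.le q.2 x
      rw [← dist_eq_norm, ← dist_eq_norm] at this
      exact this.trans_lt hq.2
  obtain ⟨h1, h2⟩ := h _ hmem
  exact ⟨_, _, h1, h2, he⟩

/-- At a simple real root, the root for `Im σ < 0` moves into the upper half plane if and only if
the two partial derivatives have the same sign. -/
lemma eventually_im_pos_iff_of_simple (G : MvPolynomial (Option (Fin (n + 1))) ℝ) (t : ℝ)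
    (η : Fin n → ℝ) (x : ℝ) (ha : (val (dσ G) (t, η) x).re ≠ 0)
    (hb : (val (dξ G) (t, η) x).re ≠ 0) :
    ∀ᶠ q : (ℂ × (Fin n → ℝ)) × ℂ in 𝓝 (((t : ℂ), η), (x : ℂ)), val G q.1 q.2 = 0 →
      q.1.1.im < 0 →
      (0 < q.2.im ↔ 0 < (val (dσ G) (t, η) x).re * (val (dξ G) (t, η) x).re) := by
  set a₀ := (val (dσ G) (t, η) x).re
  set b₀ := (val (dξ G) (t, η) x).re
  filter_upwards [eventually_im_val_eq G t η x
    (lt_min (abs_pos.2 ha) (abs_pos.2 hb))] with q hq h0 hσ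
  obtain ⟨a, b, h1, h2, h3⟩ := hq
  rw [h0, Complex.zero_im] at h3
  have h1' := h1.trans_le (min_le_left _ _)
  have h2' := h2.trans_le (min_le_right _ _)
  have key : ∀ {c c₀ : ℝ}, |c - c₀| < |c₀| → 0 < c * c₀ := by
    intro c c₀ h
    have := sq_lt_sq.2 h
    nlinarith [sq_nonneg c]
  have ka := key h1'
  have kb := key h2'
  -- both sides say that `Im ξ * b` and `b` have the same sign, as `Im ξ * b = - Im σ * a`
  have e1 : q.2.im * (b * b₀) * (a₀ * a₀) = -q.1.1.im * (a * a₀) * (a₀ * b₀) := by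
    linear_combination (-(b₀ * (a₀ * a₀))) * h3
  have p1 : 0 < (b * b₀) * (a₀ * a₀) := mul_pos kb (mul_self_pos.2 ha)
  have p2 : 0 < -q.1.1.im * (a * a₀) := mul_pos (neg_pos.2 hσ) ka
  constructor
  · intro h
    have : 0 < q.2.im * ((b * b₀) * (a₀ * a₀)) := mul_pos h p1
    rw [← mul_assoc, e1] at this
    exact (mul_pos_iff_of_pos_left p2).1 this
  · intro h
    have : 0 < -q.1.1.im * (a * a₀) * (a₀ * b₀) := mul_pos p2 h
    rw [← e1, mul_assoc] at this
    exact (mul_pos_iff_of_pos_right p1).1 this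

end Polynomials

/-! ### Real roots of multiplicity two -/

section Double

variable {n : ℕ}

lemma lt_abs_segment {g y₁ y₂ s : ℝ} (hs : s ∈ Set.Icc (0 : ℝ) 1)
    (hsame : (0 < y₁ ∧ 0 < y₂) ∨ (y₁ < 0 ∧ y₂ < 0)) (h₁ : g < |y₁|) (h₂ : g < |y₂|) :
    g < |(1 - s) * y₁ + s * y₂| := by
  have h1s := sub_nonneg.2 hs.2
  rcases hsame with ⟨p, q⟩ | ⟨p, q⟩
  · rw [abs_of_pos p] at h₁
    rw [abs_of_pos q] at h₂
    exact lt_of_lt_of_le ((convex_Ioi g) h₁ h₂ h1s hs.1 (by ring)) (le_abs_self _)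
  · rw [abs_of_neg p] at h₁
    rw [abs_of_neg q] at h₂
    refine lt_of_lt_of_le ((convex_Ioi g) h₁ h₂ h1s hs.1 (by ring)) ?_
    refine le_trans (le_of_eq ?_) (neg_le_abs _)
    simp only [smul_eq_mul]
    ring

/-- If `Im G` is a combination of `Im σ < 0` and `Im ξ` with coefficients `a` and `b`, a bound on
`a` from below and on `b` from above makes `Im ξ` large at the zeros of `G`. -/
lemma lt_abs_of_combination_eq_zero {g y a b a₀ κ : ℝ} (hg : 0 < g) (hκ : 0 < κ) (ha₀ : 0 < |a₀|)
    (h0 : 0 = -g * a + y * b) (h1 : |a - a₀| < |a₀| / 2) (h2 : |b| < |a₀| / 2 / κ) :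
    g * κ < |y| := by
  have h4 : |a₀| / 2 < |a| := by
    have := abs_sub_abs_le_abs_sub a₀ a
    rw [abs_sub_comm] at this
    linarith
  have h5 : g * |a| = |y| * |b| := by
    have : g * a = y * b := by linarith
    calc g * |a| = |g * a| := by rw [abs_mul, abs_of_pos hg]
      _ = _ := by rw [this, abs_mul]
  have hy : 0 < |y| := by
    rcases (abs_nonneg y).lt_or_eq with h | h
    · exact h
    · rw [← h, zero_mul] at h5
      have := mul_pos hg ((half_pos ha₀).trans h4)
      linarith
  have h6 : |b| * κ < |a₀| / 2 := by rwa [lt_div_iff₀ hκ] at h2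
  have h7 : g * κ * |a| = |y| * (|b| * κ) := by linear_combination κ * h5
  have h8 : |y| * (|b| * κ) < |y| * |a| := mul_lt_mul_of_pos_left (h6.trans h4) hy
  rw [← h7] at h8
  exact lt_of_mul_lt_mul_right h8 (abs_nonneg a)

/-- If `Im G` is a combination of `Im σ < 0` and a comparatively large `Im ξ`, with coefficients
close to `d₀` and `c₀`, it does not vanish. -/
lemma combination_ne_zero {g y a b c₀ d₀ : ℝ} (hg : 0 < g) (hc : 0 < |c₀|)
    (hy : g * ((2 * |d₀| + 2 * |c₀|) / |c₀|) < |y|) (h1 : |a - d₀| < |c₀| / 2)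
    (h2 : |b - c₀| < |c₀| / 2) : -g * a + y * b ≠ 0 := by
  intro h3
  set κ := (2 * |d₀| + 2 * |c₀|) / |c₀| with hκ
  have h4 : |c₀| / 2 < |b| := by
    have := abs_sub_abs_le_abs_sub c₀ b
    rw [abs_sub_comm] at this
    linarith
  have h5 : |a| < |d₀| + |c₀| := by
    have := abs_sub_abs_le_abs_sub a d₀
    linarith
  have h6 : g * |a| = |y| * |b| := by
    have : g * a = y * b := by linarith
    calc g * |a| = |g * a| := by rw [abs_mul, abs_of_pos hg]
      _ = _ := by rw [this, abs_mul]
  have h7 : κ * (|c₀| / 2) = |d₀| + |c₀| := by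
    rw [hκ]
    field_simp
  have h9 : g * κ * (|c₀| / 2) < |y| * |b| :=
    mul_lt_mul'' hy h4 (by positivity) (by positivity)
  rw [mul_assoc, h7, ← h6] at h9
  exact absurd (mul_lt_mul_of_pos_left h5 hg) (not_lt.2 h9.le)

/-- At a double real root, exactly one of the two roots for `Im σ < 0` lies in the upper half
plane: if `Im ξ₁` and `Im ξ₂` had the same sign, they would be large compared with `Im σ`, so that
`Im ∂_ξ G` would not vanish on the segment `[ξ₁, ξ₂]`, against Rolle's theorem. -/
lemma exists_nhds_im_pos_iff_of_double (G : MvPolynomial (Option (Fin (n + 1))) ℝ) (t : ℝ)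
    (η : Fin n → ℝ) (x : ℝ) (ha : (val (dσ G) (t, η) x).re ≠ 0)
    (hb : (val (dξ G) (t, η) x).re = 0) (hc : (val (dξ (dξ G)) (t, η) x).re ≠ 0) :
    ∃ s ∈ 𝓝 (((t : ℂ), η), (x : ℂ)), ∀ (w : ℂ × (Fin n → ℝ)) (ξ₁ ξ₂ : ℂ), (w, ξ₁) ∈ s →
      (w, ξ₂) ∈ s → val G w ξ₁ = 0 → val G w ξ₂ = 0 → w.1.im < 0 →
      (ξ₁ = ξ₂ → val (dξ G) w ξ₁ = 0) → (0 < ξ₁.im ↔ ¬ 0 < ξ₂.im) := by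
  set a₀ := (val (dσ G) (t, η) x).re
  set c₀ := (val (dξ (dξ G)) (t, η) x).re
  set d₀ := (val (dσ (dξ G)) (t, η) x).re
  have ha' : 0 < |a₀| := abs_pos.2 ha
  have hc' : 0 < |c₀| := abs_pos.2 hc
  -- the ratio `|Im ξ| / |Im σ|` at a root is at least `κ`
  set κ := (2 * |d₀| + 2 * |c₀|) / |c₀| with hκ
  have hκ0 : 0 < κ := by positivity
  obtain ⟨δ, hδ, h⟩ := Metric.eventually_nhds_iff_ball.1
    ((eventually_im_val_eq G t η x (lt_min (half_pos ha') (div_pos (half_pos ha') hκ0))).and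
      (eventually_im_val_eq (dξ G) t η x (half_pos hc')))
  refine ⟨_, Metric.ball_mem_nhds _ hδ, ?_⟩
  intro w ξ₁ ξ₂ hm₁ hm₂ h₁ h₂ hσ hdup
  have hlow : ∀ ξ : ℂ, (w, ξ) ∈ Metric.ball (((t : ℂ), η), (x : ℂ)) δ → val G w ξ = 0 →
      -w.1.im * κ < |ξ.im| := by
    intro ξ hm h0
    obtain ⟨⟨a, b, h1, h2, h3⟩, -⟩ := h _ hm
    rw [hb, sub_zero] at h2
    have h1' := h1.trans_le (min_le_left _ _)
    have h2' := h2.trans_le (min_le_right _ _)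
    simp only [h0, Complex.zero_im] at h3
    exact lt_abs_of_combination_eq_zero (neg_pos.2 hσ) hκ0 ha' (by rw [neg_neg]; exact h3) h1' h2'
  have l₁ := hlow ξ₁ hm₁ h₁
  have l₂ := hlow ξ₂ hm₂ h₂
  have hg : 0 < -w.1.im * κ := mul_pos (neg_pos.2 hσ) hκ0
  by_contra hcon
  have hsame : (0 < ξ₁.im ∧ 0 < ξ₂.im) ∨ (ξ₁.im < 0 ∧ ξ₂.im < 0) := by
    have n₁ : ξ₁.im ≠ 0 := abs_pos.1 (hg.trans l₁)
    have n₂ : ξ₂.im ≠ 0 := abs_pos.1 (hg.trans l₂)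
    rcases lt_or_gt_of_ne n₁ with p | p <;> rcases lt_or_gt_of_ne n₂ with q | q
    · exact Or.inr ⟨p, q⟩
    · exact absurd (by simp [q, p.le]) hcon
    · exact absurd (by simp [p, q.le]) hcon
    · exact Or.inl ⟨p, q⟩
  set line : ℝ → ℂ := fun s => ξ₁ + s * (ξ₂ - ξ₁) with hline
  have hne : ∀ s ∈ Set.Icc (0 : ℝ) 1, (val (dξ G) w (line s)).im ≠ 0 := by
    intro s hs h0
    have hmem : (w, line s) ∈ Metric.ball (((t : ℂ), η), (x : ℂ)) δ := by
      have m₁ : dist w ((t : ℂ), η) < δ ∧ dist ξ₁ x < δ := max_lt_iff.1 hm₁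
      have m₂ : dist w ((t : ℂ), η) < δ ∧ dist ξ₂ x < δ := max_lt_iff.1 hm₂
      have m₃ : ξ₁ + s • (ξ₂ - ξ₁) ∈ Metric.ball (x : ℂ) δ :=
        (convex_ball (x : ℂ) δ).add_smul_sub_mem m₁.2 m₂.2 hs
      exact max_lt_iff.2 ⟨m₁.1, by simpa [hline] using m₃⟩
    have hy : (line s).im = (1 - s) * ξ₁.im + s * ξ₂.im := by
      simp [hline]
      ring
    have hbig : -w.1.im * κ < |(line s).im| := by
      rw [hy]
      exact lt_abs_segment hs hsame l₁ l₂
    obtain ⟨-, a, b, h1, h2, h3⟩ := h _ hmem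
    simp only [h0] at h3
    exact combination_ne_zero (neg_pos.2 hσ) hc' hbig h1 h2 (by rw [neg_neg]; exact h3.symm)
  by_cases he : ξ₁ = ξ₂
  · have h0 := hne 0 (by simp)
    simp [hline, hdup he] at h0
  · have hd : ∀ s : ℝ, HasDerivAt (fun s : ℝ => (val G w (line s) / (ξ₂ - ξ₁)).im)
        (val (dξ G) w (line s)).im s := by
      intro s
      have h1 := (hasDerivAt_val_line G w ξ₁ 0 (ξ₂ - ξ₁) s).comp_ofReal
      have h2 := Complex.imCLM.hasFDerivAt.comp_hasDerivAt s (h1.div_const (ξ₂ - ξ₁))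
      have h3 : ξ₂ - ξ₁ ≠ 0 := sub_ne_zero.2 (Ne.symm he)
      simp only [mul_zero, add_zero, zero_mul, zero_add, Function.comp_def,
        mul_div_cancel_left₀ _ h3] at h2
      exact h2
    obtain ⟨s, hs, h0⟩ := exists_hasDerivAt_eq_zero zero_lt_one
      (fun s _ => (hd s).continuousAt.continuousWithinAt)
      (by simp [hline, h₁, h₂]) (fun s _ => hd s)
    exact hne s (Set.Ioo_subset_Icc_self hs) h0

end Double

/-! ### The characteristic polynomial -/

section SymbolPoly

variable {n N : ℕ} (A : Fin (n + 1) → Matrix (Fin N) (Fin N) ℝ)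

/-- The determinant of the symbol as a polynomial in `(σ, η, ξ)`. -/
noncomputable def symbolPoly : MvPolynomial (Option (Fin (n + 1))) ℝ :=
  ((MvPolynomial.X none : MvPolynomial (Option (Fin (n + 1))) ℝ) •
      (1 : Matrix (Fin N) (Fin N) (MvPolynomial (Option (Fin (n + 1))) ℝ)) +
    ∑ i, (MvPolynomial.X (some i) : MvPolynomial (Option (Fin (n + 1))) ℝ) •
      (A i).map MvPolynomial.C).det

/-- The symbol `L(σ, η, ξ)` at complex `σ` and `ξ`. -/
noncomputable def csymbol (w : ℂ × (Fin n → ℝ)) (ξ : ℂ) : Matrix (Fin N) (Fin N) ℂ :=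
  w.1 • (1 : Matrix (Fin N) (Fin N) ℂ) +
    ∑ i : Fin n, (w.2 i : ℂ) • (A i.castSucc).map Complex.ofReal +
    ξ • (A (Fin.last n)).map Complex.ofReal

lemma val_symbolPoly (w : ℂ × (Fin n → ℝ)) (ξ : ℂ) :
    val (symbolPoly A) w ξ = (csymbol A w ξ).det := by
  rw [val, symbolPoly, AlgHom.map_det, Fin.sum_univ_castSucc, csymbol]
  congr 1
  ext i j
  simp [Matrix.one_apply, Matrix.sum_apply, freq, Matrix.add_apply, apply_ite]
  ring

lemma map_symbol (t : ℝ) (η : Fin n → ℝ) (x : ℝ) :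
    (symbol A t η x).map Complex.ofReal = csymbol A (t, η) x := by
  ext i j
  simp [symbol, csymbol, Matrix.sum_apply, Matrix.one_apply, apply_ite]

lemma val_symbolPoly_real (t : ℝ) (η : Fin n → ℝ) (x : ℝ) :
    val (symbolPoly A) (t, η) x = ((symbol A t η x).det : ℂ) := by
  rw [val_symbolPoly, ← map_symbol]
  exact (RingHom.map_det Complex.ofRealHom _).symm

variable {A}

lemma isUnit_map_ofReal {M : Matrix (Fin N) (Fin N) ℝ} (h : IsUnit M) :
    IsUnit (M.map Complex.ofReal) := by
  have := h.map (Complex.ofRealHom.mapMatrix (m := Fin N))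
  exact this

lemma bdryMatrix_sub (hA : IsUnit (A (Fin.last n))) (w : ℂ × (Fin n → ℝ)) (ξ : ℂ) :
    bdryMatrix A w.1 w.2 - (Complex.I * ξ) • (1 : Matrix (Fin N) (Fin N) ℂ) =
      (-Complex.I) • (((A (Fin.last n)).map Complex.ofReal)⁻¹ * csymbol A w ξ) := by
  have hu := (Matrix.isUnit_iff_isUnit_det _).1 (isUnit_map_ofReal hA)
  rw [bdryMatrix, csymbol, Matrix.mul_add _ _ (ξ • _), Matrix.mul_smul _ ξ,
    Matrix.nonsing_inv_mul _ hu, smul_add, smul_smul, sub_eq_add_neg, neg_mul, neg_smul, neg_smul]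

/-- The roots of the characteristic polynomial of `𝒜(σ, η)` are `iξ` for the roots `ξ` of
`det L(σ, η, ·)`. -/
lemma exists_eval_charpoly (hA : IsUnit (A (Fin.last n))) :
    ∃ c : ℂ, c ≠ 0 ∧ ∀ (w : ℂ × (Fin n → ℝ)) (ξ : ℂ),
      (bdryMatrix A w.1 w.2).charpoly.eval (Complex.I * ξ) = c * val (symbolPoly A) w ξ := by
  have hu := (Matrix.isUnit_iff_isUnit_det _).1 (isUnit_map_ofReal hA)
  refine ⟨Complex.I ^ N * (((A (Fin.last n)).map Complex.ofReal)⁻¹).det, ?_, ?_⟩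
  · refine mul_ne_zero (pow_ne_zero _ Complex.I_ne_zero) ?_
    rw [Matrix.det_nonsing_inv]
    exact hu.ringInverse.ne_zero
  · intro w ξ
    have h : Matrix.scalar (Fin N) (Complex.I * ξ) - bdryMatrix A w.1 w.2 =
        Complex.I • (((A (Fin.last n)).map Complex.ofReal)⁻¹ * csymbol A w ξ) := by
      rw [← neg_inj, ← neg_smul, ← bdryMatrix_sub hA, neg_sub]
      simp [Matrix.smul_one_eq_diagonal]
    rw [Matrix.eval_charpoly, h, Matrix.det_smul, Matrix.det_mul, Fintype.card_fin,
      val_symbolPoly, mul_assoc]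

end SymbolPoly

/-! ### Real phases: glancing and incoming frequencies in terms of the determinant -/

section RealPhases

variable {n N : ℕ} {A : Fin (n + 1) → Matrix (Fin N) (Fin N) ℝ}
  {τ : Fin N → (Fin n → ℝ) × ℝ → ℝ}

/-- A real frequency, seen among the complex ones. -/
def cfreq (ζ : ℝ × (Fin n → ℝ)) : ℂ × (Fin n → ℝ) := ((ζ.1 : ℂ), ζ.2)

lemma mem_phases_iff (hA : IsUnit (A (Fin.last n))) (ζ : ℝ × (Fin n → ℝ)) (ξ : ℂ) :
    ξ ∈ phases A ζ ↔ val (symbolPoly A) (cfreq ζ) ξ = 0 := by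
  obtain ⟨c, hc, h⟩ := exists_eval_charpoly hA
  have h1 := h (cfreq ζ) ξ
  rw [phases, Set.mem_ofPred_eq, Module.End.hasEigenvalue_iff_isRoot_charpoly, bdryOp,
    charpoly_toEuclideanLin, Polynomial.IsRoot]
  change (bdryMatrix A (ζ.1 : ℂ) ζ.2).charpoly.eval _ = _ at h1
  rw [h1, mul_eq_zero, or_iff_right hc]

lemma ne_zero_of_val_eq_zero {ζ : ℝ × (Fin n → ℝ)} (hζ : ζ ≠ 0) {x : ℝ}
    (hx : val (symbolPoly A) (cfreq ζ) x = 0) : (ζ.2, x) ≠ 0 := by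
  intro h
  rw [Prod.mk_eq_zero] at h
  rw [cfreq, val_symbolPoly_real, h.1, h.2, symbol] at hx
  simp only [Pi.zero_apply, zero_smul, Finset.sum_const_zero, add_zero, Matrix.det_smul,
    Matrix.det_one, mul_one, Fintype.card_fin, Complex.ofReal_eq_zero] at hx
  exact hζ (Prod.ext (eq_zero_of_pow_eq_zero hx) h.1)

/-- At a real root `ξ` of `det L(τ, η, ·)`, where `τ = τ_k(η, ξ)`, the derivatives of the
determinant are those of `τ - τ_k` up to the factor `∏_{l ≠ k} (τ - τ_l)`, which is `∂_σ det L`. -/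
lemma derivatives_at_real_root (hyp : StrictlyHyperbolic A τ) {ζ : ℝ × (Fin n → ℝ)} {x : ℝ}
    (h0 : (ζ.2, x) ≠ 0) {k : Fin N} (hk : ζ.1 = τ k (ζ.2, x)) :
    (val (dσ (symbolPoly A)) (cfreq ζ) x).re ≠ 0 ∧
    (val (dξ (symbolPoly A)) (cfreq ζ) x).re =
      -normalDeriv τ k ζ.2 x * (val (dσ (symbolPoly A)) (cfreq ζ) x).re ∧
    (normalDeriv τ k ζ.2 x = 0 → (val (dξ (dξ (symbolPoly A))) (cfreq ζ) x).re =
      -normalDeriv₂ τ k ζ.2 x * (val (dσ (symbolPoly A)) (cfreq ζ) x).re) := by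
  obtain ⟨t, η⟩ := ζ
  simp only at h0 hk ⊢
  have hre : ∀ (s y : ℝ), (η, y) ≠ 0 →
      (val (symbolPoly A) ((s : ℂ), η) y).re = ∏ l, (s - τ l (η, y)) := by
    intro s y hy
    rw [val_symbolPoly_real, Complex.ofReal_re]
    exact hyp.factorization (η, y) hy s
  set R := ∏ l ∈ Finset.univ.erase k, (t - τ l (η, x)) with hR
  have hR0 : R ≠ 0 := by
    refine Finset.prod_ne_zero_iff.2 fun l hl => ?_
    rw [hk, sub_ne_zero]
    exact fun h => (Finset.ne_of_mem_erase hl) ((hyp.strictMono _ h0).injective h.symm)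
  have hσ : (val (dσ (symbolPoly A)) (cfreq (t, η)) x).re = R := by
    have h1 := (hasDerivAt_val_fst (symbolPoly A) (cfreq (t, η)) x).real_of_complex
    have h2 : HasDerivAt (fun s : ℝ => (s - τ k (η, x)) *
        ∏ l ∈ Finset.univ.erase k, (s - τ l (η, x))) R t := by
      have h3 : DifferentiableAt ℝ
          (fun s : ℝ => ∏ l ∈ Finset.univ.erase k, (s - τ l (η, x))) t := by fun_prop
      refine (((hasDerivAt_id t).sub_const (τ k (η, x))).fun_mul h3.hasDerivAt).congr_deriv ?_
      simp [← hk, hR]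
    refine h1.unique (h2.congr_of_eventuallyEq (Eventually.of_forall fun s => ?_))
    exact (hre s x h0).trans
      (Finset.mul_prod_erase Finset.univ (fun l => s - τ l (η, x)) (Finset.mem_univ k)).symm
  have hana : ∀ l, AnalyticAt ℝ (fun y : ℝ => τ l (η, y)) x := fun l =>
    AnalyticAt.comp (g := τ l) (hyp.analytic l (η, x) h0) (analyticAt_const.prod analyticAt_id)
  set u : ℝ → ℝ := fun y => t - τ k (η, y) with hu
  set Q : ℝ → ℝ := fun y => ∏ l ∈ Finset.univ.erase k, (t - τ l (η, y)) with hQ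
  have hu' : AnalyticAt ℝ u x := analyticAt_const.sub (hana k)
  have hQ' : AnalyticAt ℝ Q x := Finset.analyticAt_fun_prod _ fun l _ =>
    analyticAt_const.sub (hana l)
  have hux : u x = 0 := by simp [hu, hk]
  have hev : (fun y : ℝ => (val (symbolPoly A) (cfreq (t, η)) y).re) =ᶠ[𝓝 x] u * Q := by
    have : ∀ᶠ y in 𝓝 x, (η, y) ≠ 0 :=
      (Continuous.prodMk_right η).continuousAt.eventually (isOpen_ne.mem_nhds h0)
    filter_upwards [this] with y hy
    rw [Pi.mul_apply, hu, hQ]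
    simp only
    rw [Finset.mul_prod_erase Finset.univ (fun l => t - τ l (η, y)) (Finset.mem_univ k)]
    exact hre t y hy
  have hdu : deriv u x = -normalDeriv τ k η x := by
    simp [hu, normalDeriv]
  have hd1 : deriv (fun y : ℝ => (val (symbolPoly A) (cfreq (t, η)) y).re) =
      fun y : ℝ => (val (dξ (symbolPoly A)) (cfreq (t, η)) y).re := by
    funext y
    exact (hasDerivAt_val (symbolPoly A) (cfreq (t, η)) y).real_of_complex.deriv
  refine ⟨by rwa [hσ], ?_, fun hgl => ?_⟩
  · rw [← congrFun hd1 x, hev.deriv_eq, deriv_mul hu'.differentiableAt hQ'.differentiableAt, hux,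
      hσ, hdu]
    simp [hQ, hR]
  · have h1 : (val (dξ (dξ (symbolPoly A))) (cfreq (t, η)) x).re =
        iteratedDeriv 2 (fun y : ℝ => (val (symbolPoly A) (cfreq (t, η)) y).re) x := by
      rw [iteratedDeriv_succ, iteratedDeriv_one, hd1]
      exact (hasDerivAt_val (dξ (symbolPoly A)) (cfreq (t, η)) x).real_of_complex.deriv.symm
    have h2 : iteratedDeriv 2 u x = -normalDeriv₂ τ k η x := by
      simp only [hu, iteratedDeriv_succ, normalDeriv₂, iteratedDeriv_zero]
      simp
    rw [h1, hev.iteratedDeriv_eq, iteratedDeriv_mul hu'.contDiffAt hQ'.contDiffAt]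
    simp [Finset.sum_range_succ, hux, hdu, hgl, h2, hσ, hQ, hR]

/-- The sign condition that selects the glancing and incoming frequencies among the real ones. -/
def SignStable (A : Fin (n + 1) → Matrix (Fin N) (Fin N) ℝ) (ζ : ℝ × (Fin n → ℝ)) (x : ℝ) : Prop :=
  0 ≤ (val (dσ (symbolPoly A)) (cfreq ζ) x).re * (val (dξ (symbolPoly A)) (cfreq ζ) x).re

lemma exists_root_eq (hyp : StrictlyHyperbolic A τ) {ζ : ℝ × (Fin n → ℝ)} {x : ℝ}
    (h0 : (ζ.2, x) ≠ 0) (hx : val (symbolPoly A) (cfreq ζ) x = 0) :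
    ∃ k, ζ.1 = τ k (ζ.2, x) := by
  rw [cfreq, val_symbolPoly_real, hyp.factorization (ζ.2, x) h0, Complex.ofReal_eq_zero,
    Finset.prod_eq_zero_iff] at hx
  obtain ⟨k, -, hk⟩ := hx
  exact ⟨k, sub_eq_zero.1 hk⟩

lemma dσ_ne_zero (hyp : StrictlyHyperbolic A τ) {ζ : ℝ × (Fin n → ℝ)} (hζ : ζ ≠ 0) {x : ℝ}
    (hx : val (symbolPoly A) (cfreq ζ) x = 0) :
    (val (dσ (symbolPoly A)) (cfreq ζ) x).re ≠ 0 := by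
  have h0 := ne_zero_of_val_eq_zero hζ hx
  obtain ⟨k, hk⟩ := exists_root_eq hyp h0 hx
  exact (derivatives_at_real_root hyp h0 hk).1

lemma dξ_dξ_ne_zero (hyp : StrictlyHyperbolic A τ)
    (hgl : ∀ (k : Fin N) (η : Fin n → ℝ) (ξ : ℝ), (η, ξ) ≠ 0 →
      normalDeriv τ k η ξ = 0 → normalDeriv₂ τ k η ξ ≠ 0)
    {ζ : ℝ × (Fin n → ℝ)} (hζ : ζ ≠ 0) {x : ℝ} (hx : val (symbolPoly A) (cfreq ζ) x = 0)
    (hb : (val (dξ (symbolPoly A)) (cfreq ζ) x).re = 0) :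
    (val (dξ (dξ (symbolPoly A))) (cfreq ζ) x).re ≠ 0 := by
  have h0 := ne_zero_of_val_eq_zero hζ hx
  obtain ⟨k, hk⟩ := exists_root_eq hyp h0 hx
  obtain ⟨h1, h2, h3⟩ := derivatives_at_real_root hyp h0 hk
  rw [h2, mul_eq_zero, or_iff_left h1, neg_eq_zero] at hb
  rw [h3 hb]
  exact mul_ne_zero (neg_ne_zero.2 (hgl k _ _ h0 hb)) h1

lemma eq_ofReal_re {ξ : ℂ} (h : ξ.im = 0) : ξ = (ξ.re : ℂ) :=
  Complex.ext (by simp) (by simp [h])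

lemma mem_glancing_union_incoming_iff (hA : IsUnit (A (Fin.last n)))
    (hyp : StrictlyHyperbolic A τ) {ζ : ℝ × (Fin n → ℝ)} (hζ : ζ ≠ 0) (ξ : ℂ) :
    ξ ∈ glancing A τ ζ ∪ incoming A τ ζ ↔
      val (symbolPoly A) (cfreq ζ) ξ = 0 ∧ ξ.im = 0 ∧ SignStable A ζ ξ.re := by
  have hsign : ∀ k, ξ.im = 0 → val (symbolPoly A) (cfreq ζ) ξ = 0 → ζ.1 = τ k (ζ.2, ξ.re) →
      (SignStable A ζ ξ.re ↔ normalDeriv τ k ζ.2 ξ.re ≤ 0) := by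
    intro k him h0 hk
    rw [eq_ofReal_re him] at h0
    obtain ⟨h1, h2, -⟩ := derivatives_at_real_root hyp (ne_zero_of_val_eq_zero hζ h0) hk
    rw [SignStable, h2]
    set a := (val (dσ (symbolPoly A)) (cfreq ζ) ξ.re).re
    have : a * (-normalDeriv τ k ζ.2 ξ.re * a) = (a * a) * (-normalDeriv τ k ζ.2 ξ.re) := by ring
    rw [this, mul_nonneg_iff_of_pos_left (mul_self_pos.2 h1), neg_nonneg]
  constructor
  · rintro (⟨h1, h2, k, hk, h3⟩ | ⟨h1, h2, k, hk, h3⟩)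
    all_goals
      rw [mem_phases_iff hA] at h1
      refine ⟨h1, h2, (hsign k h2 h1 hk).2 ?_⟩
    · exact h3.le
    · exact h3.le
  · rintro ⟨h1, h2, h3⟩
    have h1' := h1
    rw [eq_ofReal_re h2] at h1'
    obtain ⟨k, hk⟩ := exists_root_eq hyp (ne_zero_of_val_eq_zero hζ h1') h1'
    rcases ((hsign k h2 h1 hk).1 h3).lt_or_eq with h | h
    · exact Or.inr ⟨(mem_phases_iff hA ζ ξ).2 h1, h2, k, hk, h⟩
    · exact Or.inl ⟨(mem_phases_iff hA ζ ξ).2 h1, h2, k, hk, h⟩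

lemma mem_elliptic_iff (hA : IsUnit (A (Fin.last n))) (ζ : ℝ × (Fin n → ℝ)) (ξ : ℂ) :
    ξ ∈ elliptic A ζ ↔ val (symbolPoly A) (cfreq ζ) ξ = 0 ∧ 0 < ξ.im := by
  rw [elliptic, Set.mem_ofPred_eq, mem_phases_iff hA]

/-- The real symbol and `𝒜(ζ) - iξ` have the same kernel. -/
lemma ker_symbol_eq (hA : IsUnit (A (Fin.last n))) (ζ : ℝ × (Fin n → ℝ)) (x : ℝ) :
    LinearMap.ker (Matrix.toEuclideanLin ((symbol A ζ.1 ζ.2 x).map Complex.ofReal)) =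
      LinearMap.ker (bdryOp A ζ.1 ζ.2 -
        algebraMap ℂ (Module.End ℂ (State N)) (Complex.I * x)) := by
  have hu := (Matrix.isUnit_iff_isUnit_det _).1 (isUnit_map_ofReal hA)
  have h1 : bdryOp A ζ.1 ζ.2 - algebraMap ℂ (Module.End ℂ (State N)) (Complex.I * x) =
      Matrix.toEuclideanLin (bdryMatrix A ζ.1 ζ.2 - (Complex.I * x) • 1) := by
    rw [map_sub, map_smul, bdryOp, Algebra.algebraMap_eq_smul_one]
    congr 2
    exact (Matrix.toLpLin_one 2).symm
  have h2 := bdryMatrix_sub hA (cfreq ζ) x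
  simp only [cfreq] at h2
  rw [h1, map_symbol, h2]
  ext v
  rw [LinearMap.mem_ker, LinearMap.mem_ker, map_smul, LinearMap.smul_apply, smul_eq_zero,
    or_iff_right (neg_ne_zero.2 Complex.I_ne_zero), Matrix.toLpLin_mul_same, LinearMap.comp_apply]
  constructor
  · intro h
    rw [h, map_zero]
  · intro h
    have h2 := congrArg (Matrix.toEuclideanLin ((A (Fin.last n)).map Complex.ofReal)) h
    rw [← LinearMap.comp_apply, ← Matrix.toLpLin_mul_same, Matrix.mul_nonsing_inv _ hu, map_zero,
      Matrix.toLpLin_one] at h2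
    exact h2

/-- By strict hyperbolicity, the real eigenvalues are geometrically simple: `-τ` is a simple root of
the characteristic polynomial of `∑ᵢ ηᵢ Aᵢ + ξ A_d`. -/
lemma finrank_ker_real_phase (hA : IsUnit (A (Fin.last n))) (hyp : StrictlyHyperbolic A τ)
    {ζ : ℝ × (Fin n → ℝ)} (hζ : ζ ≠ 0) {x : ℝ} (hx : val (symbolPoly A) (cfreq ζ) x = 0) :
    Module.finrank ℂ (LinearMap.ker (bdryOp A ζ.1 ζ.2 -
      algebraMap ℂ (Module.End ℂ (State N)) (Complex.I * x))) = 1 := by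
  apply le_antisymm
  · rw [← ker_symbol_eq hA]
    set B : Matrix (Fin N) (Fin N) ℂ := csymbol A (0, ζ.2) x with hB
    have hs : ∀ σ : ℂ, csymbol A (σ, ζ.2) x = σ • 1 + B := by
      intro σ
      simp [hB, csymbol, add_assoc]
    have h1 : LinearMap.ker (Matrix.toEuclideanLin ((symbol A ζ.1 ζ.2 x).map Complex.ofReal)) =
        Module.End.eigenspace (Matrix.toEuclideanLin (-B)) (ζ.1 : ℂ) := by
      rw [map_symbol, hs, Module.End.eigenspace_def, ← LinearMap.ker_neg]
      congr 1
      rw [map_add, map_smul, map_neg,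
        show Matrix.toEuclideanLin (1 : Matrix (Fin N) (Fin N) ℂ) = 1 from Matrix.toLpLin_one 2]
      abel
    rw [h1]
    refine (LinearMap.finrank_eigenspace_le _ _).trans ?_
    rw [charpoly_toEuclideanLin]
    by_contra hcon
    have h2 := (Polynomial.one_lt_rootMultiplicity_iff_isRoot
      (Matrix.charpoly_monic (-B)).ne_zero).1 (not_le.1 hcon)
    have h3 : (fun σ : ℂ => (-B).charpoly.eval σ) = fun σ => val (symbolPoly A) (σ, ζ.2) x := by
      funext σ
      rw [val_symbolPoly, hs, Matrix.eval_charpoly, sub_neg_eq_add, Matrix.smul_one_eq_diagonal]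
      rfl
    have h4 := (-B).charpoly.hasDerivAt (ζ.1 : ℂ)
    rw [h3] at h4
    have h5 := h4.unique (hasDerivAt_val_fst (symbolPoly A) (cfreq ζ) x)
    rw [h2.2.eq_zero] at h5
    exact dσ_ne_zero hyp hζ hx (by rw [← h5]; rfl)
  · rw [Nat.succ_le_iff, Module.finrank_pos_iff, Submodule.nontrivial_iff_ne_bot]
    have h1 := (mem_phases_iff hA ζ x).2 hx
    rw [phases, Set.mem_ofPred_eq] at h1
    rw [Algebra.algebraMap_eq_smul_one, ← Module.End.eigenspace_def]
    exact h1

end RealPhases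

/-! ### The number of stable roots near a real frequency -/

section Counting

open Polynomial

variable {n N : ℕ} {A : Fin (n + 1) → Matrix (Fin N) (Fin N) ℝ}
  {τ : Fin N → (Fin n → ℝ) × ℝ → ℝ}

lemma I_mul_neg_I_mul (z : ℂ) : Complex.I * (-Complex.I * z) = z := by
  rw [← mul_assoc, mul_neg, Complex.I_mul_I, neg_neg, one_mul]

lemma neg_I_mul_I_mul (z : ℂ) : -Complex.I * (Complex.I * z) = z := by
  rw [← mul_assoc, neg_mul, Complex.I_mul_I, neg_neg, one_mul]

lemma exists_eval_derivative_charpoly (hA : IsUnit (A (Fin.last n))) :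
    ∃ c : ℂ, c ≠ 0 ∧ ∀ (w : ℂ × (Fin n → ℝ)) (ξ : ℂ),
      (bdryMatrix A w.1 w.2).charpoly.eval (Complex.I * ξ) = c * val (symbolPoly A) w ξ ∧
      (bdryMatrix A w.1 w.2).charpoly.derivative.eval (Complex.I * ξ) * Complex.I =
        c * val (dξ (symbolPoly A)) w ξ ∧
      (bdryMatrix A w.1 w.2).charpoly.derivative.derivative.eval (Complex.I * ξ) * Complex.I *
        Complex.I = c * val (dξ (dξ (symbolPoly A))) w ξ := by
  obtain ⟨c, hc, h⟩ := exists_eval_charpoly hA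
  have hd : ∀ (p : ℂ[X]) (ξ : ℂ), HasDerivAt (fun ξ : ℂ => p.eval (Complex.I * ξ))
      (p.derivative.eval (Complex.I * ξ) * Complex.I) ξ := by
    intro p ξ
    have h1 : HasDerivAt (fun ξ : ℂ => Complex.I * ξ) Complex.I ξ := by
      simpa using (hasDerivAt_id ξ).const_mul Complex.I
    exact (p.hasDerivAt (Complex.I * ξ)).comp ξ h1
  have h1 : ∀ (w : ℂ × (Fin n → ℝ)) (ξ : ℂ),
      (bdryMatrix A w.1 w.2).charpoly.derivative.eval (Complex.I * ξ) * Complex.I =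
        c * val (dξ (symbolPoly A)) w ξ := by
    intro w ξ
    have h2 := hd (bdryMatrix A w.1 w.2).charpoly ξ
    simp only [h w] at h2
    exact h2.unique ((hasDerivAt_val (symbolPoly A) w ξ).const_mul c)
  refine ⟨c, hc, fun w ξ => ⟨h w ξ, h1 w ξ, ?_⟩⟩
  have h2 := (hd (bdryMatrix A w.1 w.2).charpoly.derivative ξ).mul_const Complex.I
  simp only [h1 w] at h2
  exact h2.unique ((hasDerivAt_val (dξ (symbolPoly A)) w ξ).const_mul c)

lemma isRoot_charpoly_iff (hA : IsUnit (A (Fin.last n))) (w : ℂ × (Fin n → ℝ)) (ξ : ℂ) :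
    (bdryMatrix A w.1 w.2).charpoly.IsRoot (Complex.I * ξ) ↔ val (symbolPoly A) w ξ = 0 := by
  obtain ⟨c, hc, h⟩ := exists_eval_charpoly hA
  rw [IsRoot, h, mul_eq_zero, or_iff_right hc]

lemma isRoot_derivative_charpoly_iff (hA : IsUnit (A (Fin.last n))) (w : ℂ × (Fin n → ℝ)) (ξ : ℂ) :
    (bdryMatrix A w.1 w.2).charpoly.derivative.IsRoot (Complex.I * ξ) ↔
      val (dξ (symbolPoly A)) w ξ = 0 := by
  obtain ⟨c, hc, h⟩ := exists_eval_derivative_charpoly hA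
  have := (h w ξ).2.1
  rw [IsRoot]
  constructor
  · intro h0
    rw [h0, zero_mul] at this
    exact (mul_eq_zero.1 this.symm).resolve_left hc
  · intro h0
    rw [h0, mul_zero] at this
    exact (mul_eq_zero.1 this).resolve_right Complex.I_ne_zero

lemma rootMultiplicity_eq_one (hA : IsUnit (A (Fin.last n))) {w : ℂ × (Fin n → ℝ)} {ξ : ℂ}
    (h0 : val (symbolPoly A) w ξ = 0) (h1 : val (dξ (symbolPoly A)) w ξ ≠ 0) :
    (bdryMatrix A w.1 w.2).charpoly.rootMultiplicity (Complex.I * ξ) = 1 := by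
  have hne := (bdryMatrix A w.1 w.2).charpoly_monic.ne_zero
  apply le_antisymm
  · by_contra hcon
    exact h1 ((isRoot_derivative_charpoly_iff hA w ξ).1
      ((one_lt_rootMultiplicity_iff_isRoot hne).1 (not_le.1 hcon)).2)
  · exact Nat.one_le_iff_ne_zero.2
      ((rootMultiplicity_pos hne).2 ((isRoot_charpoly_iff hA w ξ).2 h0)).ne'

lemma one_lt_rootMultiplicity (hA : IsUnit (A (Fin.last n))) {w : ℂ × (Fin n → ℝ)} {ξ : ℂ} :
    1 < (bdryMatrix A w.1 w.2).charpoly.rootMultiplicity (Complex.I * ξ) ↔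
      val (symbolPoly A) w ξ = 0 ∧ val (dξ (symbolPoly A)) w ξ = 0 := by
  rw [one_lt_rootMultiplicity_iff_isRoot (bdryMatrix A w.1 w.2).charpoly_monic.ne_zero,
    isRoot_charpoly_iff hA, isRoot_derivative_charpoly_iff hA]

lemma rootMultiplicity_eq_two (hA : IsUnit (A (Fin.last n))) {w : ℂ × (Fin n → ℝ)} {ξ : ℂ}
    (h0 : val (symbolPoly A) w ξ = 0) (h1 : val (dξ (symbolPoly A)) w ξ = 0)
    (h2 : val (dξ (dξ (symbolPoly A))) w ξ ≠ 0) :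
    (bdryMatrix A w.1 w.2).charpoly.rootMultiplicity (Complex.I * ξ) = 2 := by
  have hne := (bdryMatrix A w.1 w.2).charpoly_monic.ne_zero
  apply le_antisymm
  · by_contra hcon
    have h3 := (lt_rootMultiplicity_iff_isRoot_iterate_derivative hne).1 (not_le.1 hcon) 2 le_rfl
    obtain ⟨c, hc, h⟩ := exists_eval_derivative_charpoly hA
    have h4 := (h w ξ).2.2
    simp only [Function.iterate_succ, Function.iterate_zero, Function.comp_apply, id] at h3
    rw [h3.eq_zero, zero_mul, zero_mul] at h4
    exact (mul_ne_zero hc h2) h4.symm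
  · exact Nat.succ_le_iff.2 ((one_lt_rootMultiplicity hA).2 ⟨h0, h1⟩)

lemma continuous_bdryMatrix :
    Continuous fun w : ℂ × (Fin n → ℝ) => bdryMatrix A w.1 w.2 := by
  unfold bdryMatrix
  fun_prop

/-- Data of a passage to the limit along an ultrafilter `U` converging to a real frequency `ζ`:
convergent characteristic roots `r w i → r₀ i`. -/
structure RootLimit (A : Fin (n + 1) → Matrix (Fin N) (Fin N) ℝ) (ζ : ℝ × (Fin n → ℝ))
    (U : Ultrafilter (ℂ × (Fin n → ℝ))) (r : ℂ × (Fin n → ℝ) → Fin N → ℂ) (r₀ : Fin N → ℂ) :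
    Prop where
  le_nhds : (U : Filter (ℂ × (Fin n → ℝ))) ≤ 𝓝 (cfreq ζ)
  charpoly_eq : ∀ w, (bdryMatrix A w.1 w.2).charpoly = ∏ i, (X - C (r w i))
  tendsto : Tendsto r U (𝓝 r₀)
  charpoly_limit : (bdryMatrix A (ζ.1 : ℂ) ζ.2).charpoly = ∏ i, (X - C (r₀ i))

lemma exists_rootLimit (ζ : ℝ × (Fin n → ℝ)) (U : Ultrafilter (ℂ × (Fin n → ℝ)))
    (hU : (U : Filter (ℂ × (Fin n → ℝ))) ≤ 𝓝 (cfreq ζ)) : ∃ r r₀, RootLimit A ζ U r r₀ := by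
  choose r hr using fun w : ℂ × (Fin n → ℝ) => exists_charpoly_eq_prod (bdryMatrix A w.1 w.2)
  have hM : Tendsto (fun w : ℂ × (Fin n → ℝ) => bdryMatrix A w.1 w.2) U
      (𝓝 (bdryMatrix A (cfreq ζ).1 (cfreq ζ).2)) :=
    (continuous_bdryMatrix.tendsto (cfreq ζ)).mono_left hU
  obtain ⟨r₀, h1, h2⟩ := exists_tendsto_roots U hM hr
  exact ⟨r, r₀, hU, hr, h1, h2⟩

lemma approach_le_nhds (ζ : ℝ × (Fin n → ℝ)) : approach ζ ≤ 𝓝 (cfreq ζ) :=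
  nhdsWithin_le_nhds

lemma eventually_im_neg (ζ : ℝ × (Fin n → ℝ)) : ∀ᶠ w in approach ζ, w.1.im < 0 :=
  self_mem_nhdsWithin

variable {ζ : ℝ × (Fin n → ℝ)} {U : Ultrafilter (ℂ × (Fin n → ℝ))}
  {r : ℂ × (Fin n → ℝ) → Fin N → ℂ} {r₀ : Fin N → ℂ}

lemma RootLimit.isRoot_iff (h : RootLimit A ζ U r r₀) (hA : IsUnit (A (Fin.last n))) (ξ : ℂ) :
    val (symbolPoly A) (cfreq ζ) ξ = 0 ↔ ∃ i, r₀ i = Complex.I * ξ := by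
  rw [← isRoot_charpoly_iff hA]
  simp only [cfreq]
  rw [h.charpoly_limit, IsRoot, eval_prod, Finset.prod_eq_zero_iff]
  simp [sub_eq_zero, eq_comm]

lemma RootLimit.val_eq_zero (h : RootLimit A ζ U r r₀) (hA : IsUnit (A (Fin.last n)))
    (w : ℂ × (Fin n → ℝ)) (i : Fin N) : val (symbolPoly A) w (-Complex.I * r w i) = 0 := by
  rw [← isRoot_charpoly_iff hA, h.charpoly_eq, IsRoot, eval_prod]
  refine Finset.prod_eq_zero (Finset.mem_univ i) ?_
  rw [I_mul_neg_I_mul]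
  simp

lemma RootLimit.tendsto_phase (h : RootLimit A ζ U r r₀) {i : Fin N} {ξ : ℂ}
    (hi : r₀ i = Complex.I * ξ) :
    Tendsto (fun w => (w, -Complex.I * r w i)) U (𝓝 (cfreq ζ, ξ)) := by
  have h1 : Tendsto (fun w => -Complex.I * r w i) U (𝓝 (-Complex.I * r₀ i)) :=
    (tendsto_pi_nhds.1 h.tendsto i).const_mul _
  rw [hi, neg_I_mul_I_mul] at h1
  exact (tendsto_id.mono_left h.le_nhds).prodMk_nhds h1

lemma im_neg_I_mul (z : ℂ) : (-Complex.I * z).im = -z.re := by simp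

/-- The number of roots with negative real part that converge to a real phase: one if the phase is
glancing or incoming, none otherwise. -/
lemma RootLimit.card_real_phase (h : RootLimit A ζ U r r₀)
    (hU : (U : Filter (ℂ × (Fin n → ℝ))) ≤ approach ζ)
    (hA : IsUnit (A (Fin.last n))) (hyp : StrictlyHyperbolic A τ)
    (hgl : ∀ (k : Fin N) (η : Fin n → ℝ) (ξ : ℝ), (η, ξ) ≠ 0 →
      normalDeriv τ k η ξ = 0 → normalDeriv₂ τ k η ξ ≠ 0) (hζ : ζ ≠ 0)
    {S : Finset (Fin N)} (hS : ∀ᶠ w in (U : Filter (ℂ × (Fin n → ℝ))),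
      (Finset.univ.filter fun i => (r w i).re < 0) = S)
    {x : ℝ} (hx : val (symbolPoly A) (cfreq ζ) x = 0) [Decidable (SignStable A ζ x)] :
    (S.filter fun i => r₀ i = Complex.I * x).card = if SignStable A ζ x then 1 else 0 := by
  classical
  have ha := dσ_ne_zero hyp hζ hx
  have hneg : ∀ᶠ w in (U : Filter (ℂ × (Fin n → ℝ))), w.1.im < 0 := hU (eventually_im_neg ζ)
  have him : ∀ H : MvPolynomial (Option (Fin (n + 1))) ℝ, (val H (cfreq ζ) x).im = 0 := fun H =>
    val_im_of_real H (by simp [cfreq]) (by simp)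
  have hmult := rootMultiplicity_prod_X_sub_C r₀ (Complex.I * x)
  rw [← h.charpoly_limit] at hmult
  have hmemS : ∀ i, ∀ᶠ w in (U : Filter (ℂ × (Fin n → ℝ))),
      i ∈ S ↔ 0 < (-Complex.I * r w i).im := by
    intro i
    filter_upwards [hS] with w hw
    rw [← hw, im_neg_I_mul]
    simp
  by_cases hb : (val (dξ (symbolPoly A)) (cfreq ζ) x).re = 0
  · have hc := dξ_dξ_ne_zero hyp hgl hζ hx hb
    have hm2 := rootMultiplicity_eq_two hA hx (Complex.ext hb (him _))
      (fun h0 => hc (by rw [h0]; rfl))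
    simp only [cfreq] at hm2
    rw [hm2] at hmult
    obtain ⟨i, j, hij, hset⟩ := Finset.card_eq_two.1 hmult.symm
    have hi : r₀ i = Complex.I * x := by
      have : i ∈ Finset.univ.filter fun i => r₀ i = Complex.I * x := by simp [hset]
      exact (Finset.mem_filter.1 this).2
    have hj : r₀ j = Complex.I * x := by
      have : j ∈ Finset.univ.filter fun i => r₀ i = Complex.I * x := by simp [hset]
      exact (Finset.mem_filter.1 this).2
    obtain ⟨s, hs, hprop⟩ := exists_nhds_im_pos_iff_of_double (symbolPoly A) ζ.1 ζ.2 x ha hb hc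
    obtain ⟨w, h1, h2, h3, h4, h5⟩ := ((h.tendsto_phase hi).eventually_mem hs |>.and
      ((h.tendsto_phase hj).eventually_mem hs |>.and (hneg.and ((hmemS i).and (hmemS j))))).exists
    have hxor := hprop w _ _ h1 h2 (h.val_eq_zero hA w i) (h.val_eq_zero hA w j) h3 (by
      intro heq
      have heq' : r w i = r w j := mul_left_cancel₀ (neg_ne_zero.2 Complex.I_ne_zero) heq
      refine ((one_lt_rootMultiplicity hA).1 ?_).2
      rw [I_mul_neg_I_mul, h.charpoly_eq,
        rootMultiplicity_prod_X_sub_C, Finset.one_lt_card]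
      exact ⟨i, by simp, j, by simp [heq'], hij⟩)
    rw [← h4, ← h5] at hxor
    have hst : SignStable A ζ x := by rw [SignStable, hb, mul_zero]
    rw [if_pos hst]
    have hfil : (S.filter fun i => r₀ i = Complex.I * x) =
        ({i, j} : Finset (Fin N)).filter (· ∈ S) := by
      rw [← hset]
      ext l
      simp [and_comm]
    rw [hfil]
    by_cases hiS : i ∈ S
    · have hjS := hxor.1 hiS
      rw [Finset.filter_insert, if_pos hiS, Finset.filter_singleton, if_neg hjS]
      simp
    · have hjS : j ∈ S := by_contra fun hj' => hiS (hxor.2 hj')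
      rw [Finset.filter_insert, if_neg hiS, Finset.filter_singleton, if_pos hjS]
      simp
  · have hm1 := rootMultiplicity_eq_one hA hx (fun h0 => hb (by rw [h0]; rfl))
    simp only [cfreq] at hm1
    rw [hm1] at hmult
    obtain ⟨i, hset⟩ := Finset.card_eq_one.1 hmult.symm
    have hi : r₀ i = Complex.I * x := by
      have : i ∈ Finset.univ.filter fun i => r₀ i = Complex.I * x := by simp [hset]
      exact (Finset.mem_filter.1 this).2
    obtain ⟨w, h1, h2, h3⟩ := ((h.tendsto_phase hi).eventually
      (eventually_im_pos_iff_of_simple (symbolPoly A) ζ.1 ζ.2 x ha hb) |>.and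
        (hneg.and (hmemS i))).exists
    have h4 := h1 (h.val_eq_zero hA w i) h2
    have hst : SignStable A ζ x ↔ i ∈ S := by
      rw [h3, h4, SignStable]
      exact ⟨fun h => lt_of_le_of_ne h (mul_ne_zero ha hb).symm, le_of_lt⟩
    have hfil : (S.filter fun i => r₀ i = Complex.I * x) =
        ({i} : Finset (Fin N)).filter (· ∈ S) := by
      rw [← hset]
      ext l
      simp [and_comm]
    rw [hfil, Finset.filter_singleton]
    split_ifs with h5 h6 h6
    · simp
    · exact absurd (hst.2 h5) h6
    · exact absurd (hst.1 h6) h5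
    · simp

lemma RootLimit.mem_of_re_neg (h : RootLimit A ζ U r r₀) {S : Finset (Fin N)}
    (hS : ∀ᶠ w in (U : Filter (ℂ × (Fin n → ℝ))),
      (Finset.univ.filter fun i => (r w i).re < 0) = S) {i : Fin N}
    (hi : (r₀ i).re < 0) : i ∈ S := by
  have h1 : Tendsto (fun w => (r w i).re) U (𝓝 (r₀ i).re) :=
    (Complex.continuous_re.tendsto _).comp (tendsto_pi_nhds.1 h.tendsto i)
  obtain ⟨w, h2, h3⟩ := (hS.and (h1.eventually (gt_mem_nhds hi))).exists
  rw [← h2]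
  simpa using h3

lemma RootLimit.notMem_of_re_pos (h : RootLimit A ζ U r r₀) {S : Finset (Fin N)}
    (hS : ∀ᶠ w in (U : Filter (ℂ × (Fin n → ℝ))),
      (Finset.univ.filter fun i => (r w i).re < 0) = S) {i : Fin N}
    (hi : 0 < (r₀ i).re) : i ∉ S := by
  have h1 : Tendsto (fun w => (r w i).re) U (𝓝 (r₀ i).re) :=
    (Complex.continuous_re.tendsto _).comp (tendsto_pi_nhds.1 h.tendsto i)
  obtain ⟨w, h2, h3⟩ := (hS.and (h1.eventually (lt_mem_nhds hi))).exists
  rw [← h2]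
  simpa using h3.le

end Counting

/-! ### Stable indices and components -/

section Components

open Polynomial

variable {n N : ℕ} {A : Fin (n + 1) → Matrix (Fin N) (Fin N) ℝ}
  {τ : Fin N → (Fin n → ℝ) × ℝ → ℝ} {ζ : ℝ × (Fin n → ℝ)}

open Classical in
/-- The number, with multiplicity, of eigenvalues of `𝒜(w)` of negative real part at distance less
than `ε` from `z`. -/
noncomputable def nearCount (A : Fin (n + 1) → Matrix (Fin N) (Fin N) ℝ) (w : ℂ × (Fin n → ℝ))
    (z : ℂ) (ε : ℝ) : ℕ :=
  Multiset.card ((bdryMatrix A w.1 w.2).charpoly.roots.filter fun y => y.re < 0 ∧ dist y z < ε)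

lemma nearCount_eq_card {w : ℂ × (Fin n → ℝ)} {r : Fin N → ℂ}
    (hr : (bdryMatrix A w.1 w.2).charpoly = ∏ i, (X - C (r i))) (z : ℂ) (ε : ℝ) :
    nearCount A w z ε =
      (Finset.univ.filter fun i => (r i).re < 0 ∧ dist (r i) z < ε).card := by
  classical
  rw [nearCount, hr, roots_prod_X_sub_C_univ, Multiset.filter_map, Multiset.card_map,
    ← Finset.card_val, Finset.filter_val]
  congr! 2

/-- A property of the number of stable roots converging to `z`, for all passages to the limit, holds
for the number of stable roots close to `z`. -/
lemma eventually_nearCount {z : ℂ} {q : ℕ → Prop}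
    (h : ∀ (U : Ultrafilter (ℂ × (Fin n → ℝ))) (r : ℂ × (Fin n → ℝ) → Fin N → ℂ) (r₀ : Fin N → ℂ)
      (S : Finset (Fin N)), (U : Filter (ℂ × (Fin n → ℝ))) ≤ approach ζ → RootLimit A ζ U r r₀ →
      (∀ᶠ w in (U : Filter (ℂ × (Fin n → ℝ))),
        (Finset.univ.filter fun i => (r w i).re < 0) = S) →
      q (S.filter fun i => r₀ i = z).card) :
    ∀ᶠ ε : ℝ in 𝓝[>] 0, ∀ᶠ w in approach ζ, q (nearCount A w z ε) := by
  classical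
  obtain ⟨ε₀, hε₀, hiso⟩ : ∃ ε₀ > 0, ∀ y, (bdryMatrix A (ζ.1 : ℂ) ζ.2).charpoly.IsRoot y →
      y ≠ z → ε₀ ≤ dist y z := by
    set F := (bdryMatrix A (ζ.1 : ℂ) ζ.2).charpoly.roots.toFinset.erase z
    have hopen : ((F : Set ℂ)ᶜ) ∈ 𝓝 z :=
      F.finite_toSet.isClosed.isOpen_compl.mem_nhds (by simp [F])
    obtain ⟨ε₀, h0, h1⟩ := Metric.mem_nhds_iff.1 hopen
    refine ⟨ε₀, h0, fun y hy hyz => ?_⟩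
    by_contra hcon
    exact h1 (Metric.mem_ball.2 (not_le.1 hcon))
      (by simpa [F, hyz, (Matrix.charpoly_monic _).ne_zero] using hy)
  filter_upwards [Ioo_mem_nhdsGT hε₀] with ε hε
  rw [Filter.Eventually, mem_iff_ultrafilter]
  intro U hU
  obtain ⟨r, r₀, hlim⟩ := exists_rootLimit (A := A) ζ U (hU.trans (approach_le_nhds ζ))
  obtain ⟨S, hS⟩ := exists_eventually_filter_eq U (fun w i => (r w i).re < 0)
  have hi : ∀ᶠ w in (U : Filter (ℂ × (Fin n → ℝ))), ∀ i, (dist (r w i) z < ε ↔ r₀ i = z) := by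
    rw [eventually_all]
    intro i
    have ht : Tendsto (fun w => dist (r w i) z) U (𝓝 (dist (r₀ i) z)) :=
      (tendsto_pi_nhds.1 hlim.tendsto i).dist tendsto_const_nhds
    by_cases hz : r₀ i = z
    · rw [hz, dist_self] at ht
      filter_upwards [ht.eventually (gt_mem_nhds hε.1)] with w hw
      simp [hw, hz]
    · have hroot : (bdryMatrix A (ζ.1 : ℂ) ζ.2).charpoly.IsRoot (r₀ i) := by
        rw [hlim.charpoly_limit, IsRoot, eval_prod]
        exact Finset.prod_eq_zero (Finset.mem_univ i) (by simp)
      filter_upwards [ht.eventually (lt_mem_nhds (hε.2.trans_le (hiso _ hroot hz)))] with w hw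
      simp [hz, hw.le]
  change ∀ᶠ w in (U : Filter (ℂ × (Fin n → ℝ))), q (nearCount A w z ε)
  filter_upwards [hS, hi] with w h1 h2
  rw [nearCount_eq_card (hlim.charpoly_eq w)]
  have h3 := h U r r₀ S hU hlim hS
  rw [← h1, Finset.filter_filter] at h3
  simpa only [h2] using h3

lemma tendsto_approach (ζ : ℝ × (Fin n → ℝ)) :
    Tendsto (fun γ : ℝ => ((ζ.1 : ℂ) - Complex.I * γ, ζ.2)) (𝓝[>] 0) (approach ζ) := by
  refine tendsto_nhdsWithin_iff.2 ⟨?_, ?_⟩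
  · have : Continuous fun γ : ℝ => ((ζ.1 : ℂ) - Complex.I * γ, ζ.2) := by fun_prop
    have h := (this.tendsto 0).mono_left (nhdsWithin_le_nhds (s := Set.Ioi 0))
    simpa using h
  · filter_upwards [self_mem_nhdsWithin] with γ hγ
    simpa using hγ

instance approach_neBot (ζ : ℝ × (Fin n → ℝ)) : (approach ζ).NeBot :=
  (tendsto_approach ζ).neBot

section

variable (hA : IsUnit (A (Fin.last n))) (hyp : StrictlyHyperbolic A τ)
  (hgl : ∀ (k : Fin N) (η : Fin n → ℝ) (ξ : ℝ), (η, ξ) ≠ 0 →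
    normalDeriv τ k η ξ = 0 → normalDeriv₂ τ k η ξ ≠ 0) (hζ : ζ ≠ 0)
include hA hyp hgl hζ

lemma stableIndex_eq_one {ξ : ℂ} (hξ : ξ ∈ glancing A τ ζ ∪ incoming A τ ζ) :
    stableIndex A ζ ξ = 1 := by
  classical
  obtain ⟨h0, him, hst⟩ := (mem_glancing_union_incoming_iff hA hyp hζ ξ).1 hξ
  have h1 : ∀ᶠ ε : ℝ in 𝓝[>] 0, ∀ᶠ γ : ℝ in 𝓝[>] 0, stableCount A ζ ξ ε γ = 1 := by
    have h2 := eventually_nearCount (A := A) (ζ := ζ) (z := Complex.I * ξ) (q := fun m => m = 1)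
      (fun U r r₀ S hU hlim hS => by
        rw [eq_ofReal_re him] at h0 ⊢
        rw [hlim.card_real_phase hU hA hyp hgl hζ hS h0, if_pos hst])
    filter_upwards [h2] with ε hε
    exact (tendsto_approach ζ).eventually hε
  have h3 : {m : ℕ | ∀ᶠ ε : ℝ in 𝓝[>] 0, ∀ᶠ γ : ℝ in 𝓝[>] 0, stableCount A ζ ξ ε γ = m} = {1} := by
    ext m
    constructor
    · intro hm
      obtain ⟨ε, h4, h5⟩ := (h1.and hm).exists
      obtain ⟨γ, h6, h7⟩ := (h4.and h5).exists
      exact (h7.symm.trans h6)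
    · rintro rfl
      exact h1
  rw [stableIndex, h3, csInf_singleton]

lemma component_of_real {ξ : ℂ} (hξ : ξ ∈ glancing A τ ζ ∪ incoming A τ ζ) :
    component A τ ζ ξ = LinearMap.ker (bdryOp A ζ.1 ζ.2 -
      algebraMap ℂ (Module.End ℂ (State N)) (Complex.I * ξ)) := by
  obtain ⟨h0, him, hst⟩ := (mem_glancing_union_incoming_iff hA hyp hζ ξ).1 hξ
  have hne : ξ ∉ elliptic A ζ := fun h => h.2.ne' him
  rw [component, if_neg hne]
  split_ifs with h1 h2
  · rw [ker_symbol_eq hA, ← eq_ofReal_re him]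
  · rw [stableIndex_eq_one hA hyp hgl hζ hξ, pow_one]
  · exact absurd hξ (fun h => h.elim h2 h1)

omit hA hyp hgl hζ in
lemma component_of_elliptic {ξ : ℂ} (hξ : ξ ∈ elliptic A ζ) :
    component A τ ζ ξ = (bdryOp A ζ.1 ζ.2).maxGenEigenspace (Complex.I * ξ) := by
  rw [component, if_pos hξ]

omit hA hyp hgl hζ in
lemma component_of_notMem {ξ : ℂ} (hξ : ξ ∉ stablePhases A τ ζ) : component A τ ζ ξ = ⊥ := by
  simp only [stablePhases, Set.mem_union, not_or] at hξ
  rw [component, if_neg hξ.2, if_neg hξ.1.2, if_neg hξ.1.1]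

lemma component_le_maxGenEigenspace (ξ : ℂ) :
    component A τ ζ ξ ≤ (bdryOp A ζ.1 ζ.2).maxGenEigenspace (Complex.I * ξ) := by
  by_cases h1 : ξ ∈ elliptic A ζ
  · rw [component_of_elliptic h1]
  · by_cases h2 : ξ ∈ glancing A τ ζ ∪ incoming A τ ζ
    · rw [component_of_real hA hyp hgl hζ h2, Algebra.algebraMap_eq_smul_one,
        ← Module.End.eigenspace_def]
      exact Module.End.genEigenspace_le_maximal _ _ _
    · rw [component_of_notMem (fun h => h.elim h2 h1)]
      exact bot_le

lemma iSupIndep_component : iSupIndep (component A τ ζ) := by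
  have h1 := (bdryOp A ζ.1 ζ.2).independent_maxGenEigenspace.comp
    (f := fun ξ : ℂ => Complex.I * ξ) (mul_right_injective₀ Complex.I_ne_zero)
  exact h1.mono (component_le_maxGenEigenspace hA hyp hgl hζ)

variable {U : Ultrafilter (ℂ × (Fin n → ℝ))} {r : ℂ × (Fin n → ℝ) → Fin N → ℂ} {r₀ : Fin N → ℂ}

/-- The dimension of a component is the number of stable roots converging to its eigenvalue. -/
lemma card_eq_finrank_component (hU : (U : Filter (ℂ × (Fin n → ℝ))) ≤ approach ζ)
    (hlim : RootLimit A ζ U r r₀) {S : Finset (Fin N)}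
    (hS : ∀ᶠ w in (U : Filter (ℂ × (Fin n → ℝ))),
      (Finset.univ.filter fun i => (r w i).re < 0) = S) (ξ : ℂ) :
    (S.filter fun i => r₀ i = Complex.I * ξ).card =
      Module.finrank ℂ (component A τ ζ ξ) := by
  classical
  by_cases h0 : val (symbolPoly A) (cfreq ζ) ξ = 0
  · rcases lt_trichotomy ξ.im 0 with him | him | him
    · have h1 : ξ ∉ stablePhases A τ ζ := by
        rintro (h | h)
        · exact him.ne ((mem_glancing_union_incoming_iff hA hyp hζ ξ).1 h).2.1
        · exact him.not_gt h.2
      rw [component_of_notMem h1, finrank_bot, Finset.card_eq_zero, Finset.filter_eq_empty_iff]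
      intro i hi hir
      exact hlim.notMem_of_re_pos hS (by rw [hir]; simpa using him) hi
    · have h0' := h0
      rw [eq_ofReal_re him] at h0'
      have h1 := hlim.card_real_phase hU hA hyp hgl hζ hS h0'
      rw [← eq_ofReal_re him] at h1
      rw [h1]
      split_ifs with hst
      · have h2 := (mem_glancing_union_incoming_iff hA hyp hζ ξ).2 ⟨h0, him, hst⟩
        rw [component_of_real hA hyp hgl hζ h2, eq_ofReal_re him,
          finrank_ker_real_phase hA hyp hζ h0']
      · have h2 : ξ ∉ stablePhases A τ ζ := by
          rintro (h | h)
          · exact hst ((mem_glancing_union_incoming_iff hA hyp hζ ξ).1 h).2.2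
          · exact h.2.ne' him
        rw [component_of_notMem h2, finrank_bot]
    · rw [component_of_elliptic ((mem_elliptic_iff hA ζ ξ).2 ⟨h0, him⟩),
        LinearMap.finrank_maxGenEigenspace_eq, bdryOp, charpoly_toEuclideanLin,
        hlim.charpoly_limit, rootMultiplicity_prod_X_sub_C]
      congr 1
      ext i
      simp only [Finset.mem_filter, Finset.mem_univ, true_and, and_iff_right_iff_imp]
      intro hi
      exact hlim.mem_of_re_neg hS (by rw [hi]; simpa using him)
  · have h1 : ξ ∉ stablePhases A τ ζ := by
      rintro (h | h)
      · exact h0 ((mem_glancing_union_incoming_iff hA hyp hζ ξ).1 h).1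
      · exact h0 ((mem_elliptic_iff hA ζ ξ).1 h).1
    rw [component_of_notMem h1, finrank_bot, Finset.card_eq_zero, Finset.filter_eq_empty_iff]
    intro i _ hi
    exact h0 ((hlim.isRoot_iff hA ξ).2 ⟨i, hi⟩)

lemma finrank_iSup_component (hU : (U : Filter (ℂ × (Fin n → ℝ))) ≤ approach ζ)
    (hlim : RootLimit A ζ U r r₀) {S : Finset (Fin N)}
    (hS : ∀ᶠ w in (U : Filter (ℂ × (Fin n → ℝ))),
      (Finset.univ.filter fun i => (r w i).re < 0) = S) :
    Module.finrank ℂ (⨆ ξ, component A τ ζ ξ : Submodule ℂ (State N)) = S.card := by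
  classical
  set F : Finset ℂ := Finset.univ.image fun i => -Complex.I * r₀ i with hF
  have h1 : (⨆ ξ, component A τ ζ ξ) = ⨆ ξ ∈ F, component A τ ζ ξ := by
    refine le_antisymm (iSup_le fun ξ => ?_) (iSup₂_le fun ξ _ => le_iSup (component A τ ζ) ξ)
    by_cases hξ : ξ ∈ F
    · exact le_iSup₂_of_le ξ hξ le_rfl
    · have h2 := card_eq_finrank_component hA hyp hgl hζ hU hlim hS ξ
      rw [Finset.card_eq_zero.2 ?_] at h2
      · rw [Submodule.finrank_eq_zero.1 h2.symm]
        exact bot_le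
      · rw [Finset.filter_eq_empty_iff]
        intro i _ hi
        refine hξ (Finset.mem_image.2 ⟨i, Finset.mem_univ i, ?_⟩)
        rw [hi, neg_I_mul_I_mul]
  rw [h1, finrank_biSup_eq_sum _ (iSupIndep_component hA hyp hgl hζ),
    Finset.card_eq_sum_card_fiberwise (f := fun i => -Complex.I * r₀ i) (t := F)
      (fun i _ => by simp [hF])]
  refine Finset.sum_congr rfl fun ξ _ => ?_
  rw [← card_eq_finrank_component hA hyp hgl hζ hU hlim hS ξ]
  congr 1
  ext i
  simp only [Finset.mem_filter, and_congr_right_iff]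
  intro _
  constructor
  · intro h
    rw [h, neg_I_mul_I_mul]
  · intro h
    rw [← h, I_mul_neg_I_mul]

end

end Components

/-! ### The limit of the stable subspaces -/

section Limit

open Polynomial

variable {n N : ℕ} {A : Fin (n + 1) → Matrix (Fin N) (Fin N) ℝ}
  {τ : Fin N → (Fin n → ℝ) × ℝ → ℝ} {ζ : ℝ × (Fin n → ℝ)}

lemma tendsto_clm_apply {W : Type*} {l : Filter W} {T : W → State N →L[ℂ] State N}
    {T₀ : State N →L[ℂ] State N} (hT : Tendsto T l (𝓝 T₀)) {v : W → State N} {v₀ : State N}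
    (hv : Tendsto v l (𝓝 v₀)) : Tendsto (fun w => T w (v w)) l (𝓝 (T₀ v₀)) := by
  have h : Continuous fun p : (State N →L[ℂ] State N) × State N => p.1 p.2 :=
    continuous_fst.clm_apply continuous_snd
  exact (h.tendsto (T₀, v₀)).comp (hT.prodMk_nhds hv)

lemma tendsto_aeval_prod_apply {W ι : Type*} {l : Filter W} {T : W → State N →L[ℂ] State N}
    {T₀ : State N →L[ℂ] State N} (hT : Tendsto T l (𝓝 T₀)) {r : W → ι → ℂ} {r₀ : ι → ℂ}
    (hr : Tendsto r l (𝓝 r₀)) (S : Finset ι) {v : W → State N} {v₀ : State N}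
    (hv : Tendsto v l (𝓝 v₀)) :
    Tendsto (fun w => aeval (T w : Module.End ℂ (State N)) (∏ i ∈ S, (X - C (r w i))) (v w)) l
      (𝓝 (aeval (T₀ : Module.End ℂ (State N)) (∏ i ∈ S, (X - C (r₀ i))) v₀)) := by
  classical
  induction S using Finset.induction_on generalizing v v₀ with
  | empty => simpa using hv
  | insert a S ha ih =>
    have h1 : Tendsto (fun w => T w (v w) - r w a • v w) l (𝓝 (T₀ v₀ - r₀ a • v₀)) :=
      (tendsto_clm_apply hT hv).sub ((tendsto_pi_nhds.1 hr a).smul hv)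
    have h2 := ih h1
    have h3 : ∀ (L : State N →L[ℂ] State N) (ρ : ι → ℂ) (x : State N),
        aeval (L : Module.End ℂ (State N)) (∏ i ∈ insert a S, (X - C (ρ i))) x =
          aeval (L : Module.End ℂ (State N)) (∏ i ∈ S, (X - C (ρ i))) (L x - ρ a • x) := by
      intro L ρ x
      rw [Finset.prod_insert ha, mul_comm, map_mul, Module.End.mul_apply]
      simp [Algebra.algebraMap_eq_smul_one]
    simpa only [h3] using h2

/-- The limit of orthogonal projections of constant rank is a projection of the same rank. -/
lemma finrank_range_of_tendsto {W : Type*} {l : Filter W} [l.NeBot] {E : W → Submodule ℂ (State N)}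
    {Q : State N →L[ℂ] State N} (hQ : Tendsto (fun w => (E w).starProjection) l (𝓝 Q)) {m : ℕ}
    (hm : ∀ᶠ w in l, Module.finrank ℂ (E w) = m) :
    IsIdempotentElem (Q : State N →ₗ[ℂ] State N) ∧
      Module.finrank ℂ (LinearMap.range (Q : State N →ₗ[ℂ] State N)) = m := by
  have h1 : IsIdempotentElem Q := by
    have h2 : Tendsto (fun w => (E w).starProjection * (E w).starProjection) l (𝓝 (Q * Q)) :=
      hQ.mul hQ
    have h3 : (fun w => (E w).starProjection * (E w).starProjection) =
        fun w => (E w).starProjection :=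
      funext fun w => (E w).isIdempotentElem_starProjection
    rw [h3] at h2
    exact tendsto_nhds_unique h2 hQ
  have h1' : IsIdempotentElem (Q : State N →ₗ[ℂ] State N) :=
    h1.map ContinuousLinearMap.toLinearMapRingHom
  refine ⟨h1', ?_⟩
  have htr : Continuous fun T : State N →L[ℂ] State N =>
      LinearMap.trace ℂ (State N) (T : State N →ₗ[ℂ] State N) :=
    LinearMap.continuous_of_finiteDimensional
      ((LinearMap.trace ℂ (State N)).comp (ContinuousLinearMap.coeLM ℂ))
  have h4 := (htr.tendsto Q).comp hQ
  have h5 : ∀ᶠ w in l, (m : ℂ) = LinearMap.trace ℂ (State N)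
      ((E w).starProjection : State N →ₗ[ℂ] State N) := by
    filter_upwards [hm] with w hw
    have hp : LinearMap.IsProj (E w) ((E w).starProjection : State N →ₗ[ℂ] State N) :=
      ⟨fun x => (E w).starProjection_apply_mem x,
        fun x hx => Submodule.starProjection_eq_self_iff.2 hx⟩
    rw [hp.trace, hw]
  have h6 := tendsto_nhds_unique (tendsto_const_nhds.congr' h5) h4
  have h7 := (LinearMap.IsProj.trace ((LinearMap.isProj_range_iff_isIdempotentElem _).2 h1'))
  rw [← h6] at h7
  exact_mod_cast h7.symm

section

variable (hA : IsUnit (A (Fin.last n))) (hyp : StrictlyHyperbolic A τ)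
  (hgl : ∀ (k : Fin N) (η : Fin n → ℝ) (ξ : ℝ), (η, ξ) ≠ 0 →
    normalDeriv τ k η ξ = 0 → normalDeriv₂ τ k η ξ ≠ 0) (hζ : ζ ≠ 0)
include hA hyp hgl hζ

variable {U : Ultrafilter (ℂ × (Fin n → ℝ))} {r : ℂ × (Fin n → ℝ) → Fin N → ℂ} {r₀ : Fin N → ℂ}

/-- The kernel at the limit is contained in the sum of the components: at a real eigenvalue only one
factor is present, elsewhere the component is the whole generalized eigenspace. -/
lemma ker_aeval_limit_le (hU : (U : Filter (ℂ × (Fin n → ℝ))) ≤ approach ζ)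
    (hlim : RootLimit A ζ U r r₀) {S : Finset (Fin N)}
    (hS : ∀ᶠ w in (U : Filter (ℂ × (Fin n → ℝ))),
      (Finset.univ.filter fun i => (r w i).re < 0) = S) :
    LinearMap.ker (aeval (bdryOp A ζ.1 ζ.2) (∏ i ∈ S, (X - C (r₀ i)))) ≤
      ⨆ ξ, component A τ ζ ξ := by
  classical
  rw [Finset.prod_comp (fun z => (X - C z : ℂ[X])) r₀]
  refine (ker_aeval_prod_le _ _ _).trans (iSup₂_le fun z hz => ?_)
  refine le_trans ?_ (le_iSup (component A τ ζ) (-Complex.I * z))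
  have h1 := card_eq_finrank_component hA hyp hgl hζ hU hlim hS (-Complex.I * z)
  rw [I_mul_neg_I_mul] at h1
  have hpos : 0 < (S.filter fun i => r₀ i = z).card := by
    obtain ⟨i, hi, hiz⟩ := Finset.mem_image.1 hz
    exact Finset.card_pos.2 ⟨i, Finset.mem_filter.2 ⟨hi, hiz⟩⟩
  rw [ker_aeval_X_sub_C_pow]
  by_cases he : -Complex.I * z ∈ elliptic A ζ
  · rw [component_of_elliptic he, I_mul_neg_I_mul, Algebra.algebraMap_eq_smul_one,
      ← Module.End.genEigenspace_nat]
    exact Module.End.genEigenspace_le_maximal _ _ _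
  · by_cases hr : -Complex.I * z ∈ glancing A τ ζ ∪ incoming A τ ζ
    · have h2 := (mem_glancing_union_incoming_iff hA hyp hζ _).1 hr
      rw [component_of_real hA hyp hgl hζ hr] at h1 ⊢
      rw [eq_ofReal_re h2.2.1, finrank_ker_real_phase hA hyp hζ
        (by rw [← eq_ofReal_re h2.2.1]; exact h2.1)] at h1
      rw [I_mul_neg_I_mul, h1, pow_one]
    · rw [component_of_notMem (fun h => h.elim hr he), finrank_bot] at h1
      exact absurd h1 hpos.ne'

omit hA hyp hgl hζ in
lemma RootLimit.charpoly_bdryOp (hlim : RootLimit A ζ U r r₀) (w : ℂ × (Fin n → ℝ)) :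
    (bdryOp A w.1 w.2).charpoly = ∏ i, (X - C (r w i)) := by
  rw [bdryOp, charpoly_toEuclideanLin, hlim.charpoly_eq]

/-- A limit of the projections on the stable subspaces has its range in the sum of the
components. -/
lemma range_limit_le (hU : (U : Filter (ℂ × (Fin n → ℝ))) ≤ approach ζ)
    (hlim : RootLimit A ζ U r r₀) {S : Finset (Fin N)}
    (hS : ∀ᶠ w in (U : Filter (ℂ × (Fin n → ℝ))),
      (Finset.univ.filter fun i => (r w i).re < 0) = S) {Q : State N →L[ℂ] State N}
    (hQ : Tendsto (fun w : ℂ × (Fin n → ℝ) => (stableSubspace A w.1 w.2).starProjection) U (𝓝 Q)) :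
    LinearMap.range (Q : State N →ₗ[ℂ] State N) ≤ ⨆ ξ, component A τ ζ ξ := by
  have hT : Tendsto (fun w : ℂ × (Fin n → ℝ) => opCLM (bdryMatrix A w.1 w.2)) U
      (𝓝 (opCLM (bdryMatrix A (cfreq ζ).1 (cfreq ζ).2))) :=
    ((continuous_opCLM.comp continuous_bdryMatrix).tendsto (cfreq ζ)).mono_left hlim.le_nhds
  refine le_trans ?_ (ker_aeval_limit_le hA hyp hgl hζ hU hlim hS)
  rintro _ ⟨v, rfl⟩
  have h1 := tendsto_aeval_prod_apply hT hlim.tendsto S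
    (tendsto_clm_apply hQ (tendsto_const_nhds (x := v)))
  have h2 : ∀ᶠ w in (U : Filter (ℂ × (Fin n → ℝ))), (0 : State N) =
      aeval (opCLM (bdryMatrix A w.1 w.2) : Module.End ℂ (State N)) (∏ i ∈ S, (X - C (r w i)))
        ((stableSubspace A w.1 w.2).starProjection v) := by
    filter_upwards [hS] with w hw
    have h3 : stableSubspace A w.1 w.2 ≤
        LinearMap.ker (aeval (bdryOp A w.1 w.2) (∏ i ∈ S, (X - C (r w i)))) := by
      refine iSup_le fun z =>
        maxGenEigenspace_le_ker_aeval_prod (hlim.charpoly_bdryOp w) S fun i hi => ?_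
      rw [← hw]
      simpa [hi] using z.2
    rw [coe_opCLM]
    exact (LinearMap.mem_ker.1 (h3 ((stableSubspace A w.1 w.2).starProjection_apply_mem v))).symm
  have h4 := tendsto_nhds_unique (tendsto_const_nhds.congr' h2) h1
  rw [coe_opCLM] at h4
  exact h4.symm

/-- Along an ultrafilter, the stable subspaces converge to the sum of the components. -/
lemma limit_along_ultrafilter (hU : (U : Filter (ℂ × (Fin n → ℝ))) ≤ approach ζ) :
    (∀ᶠ w in (U : Filter (ℂ × (Fin n → ℝ))), Module.finrank ℂ (stableSubspace A w.1 w.2) =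
      Module.finrank ℂ (⨆ ξ, component A τ ζ ξ : Submodule ℂ (State N))) ∧
    ∀ v, Tendsto (fun w : ℂ × (Fin n → ℝ) => (stableSubspace A w.1 w.2).starProjection v) U
      (𝓝 v) ↔ v ∈ ⨆ ξ, component A τ ζ ξ := by
  classical
  obtain ⟨r, r₀, hlim⟩ := exists_rootLimit (A := A) ζ U (hU.trans (approach_le_nhds ζ))
  obtain ⟨S, hS⟩ := exists_eventually_filter_eq U (fun w i => (r w i).re < 0)
  have hdim : ∀ᶠ w in (U : Filter (ℂ × (Fin n → ℝ))),
      Module.finrank ℂ (stableSubspace A w.1 w.2) = S.card := by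
    filter_upwards [hS] with w hw
    rw [stableSubspace,
      finrank_iSup_maxGenEigenspace (hlim.charpoly_bdryOp w) (fun z => z.re < 0), hw]
  have hD := finrank_iSup_component hA hyp hgl hζ hU hlim hS
  refine ⟨by rw [hD]; exact hdim, ?_⟩
  have hmem : Metric.closedBall (0 : State N →L[ℂ] State N) 1 ∈
      U.map fun w : ℂ × (Fin n → ℝ) => (stableSubspace A w.1 w.2).starProjection :=
    Eventually.of_forall (f := (U : Filter (ℂ × (Fin n → ℝ)))) fun w =>
      mem_closedBall_zero_iff.2 (stableSubspace A w.1 w.2).starProjection_norm_le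
  obtain ⟨Q, -, hQ⟩ := (isCompact_closedBall (0 : State N →L[ℂ] State N) 1).ultrafilter_le_nhds
    _ (le_principal_iff.2 hmem)
  have hQ' : Tendsto (fun w : ℂ × (Fin n → ℝ) => (stableSubspace A w.1 w.2).starProjection) U
    (𝓝 Q) := hQ
  obtain ⟨hid, hrank⟩ := finrank_range_of_tendsto hQ' hdim
  have hQv : ∀ v, Tendsto (fun w : ℂ × (Fin n → ℝ) => (stableSubspace A w.1 w.2).starProjection v)
      U (𝓝 (Q v)) := fun v => tendsto_clm_apply hQ' tendsto_const_nhds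
  have heq := Submodule.eq_of_le_of_finrank_eq (range_limit_le hA hyp hgl hζ hU hlim hS hQ')
    (hrank.trans hD.symm)
  intro v
  rw [← heq]
  constructor
  · intro h
    exact ⟨v, tendsto_nhds_unique (hQv v) h⟩
  · rintro ⟨u, rfl⟩
    have := hQv (Q u)
    have h5 : Q (Q u) = Q u := LinearMap.congr_fun hid u
    rw [h5] at this
    exact this

lemma iSup_component_eq_Eminus : (⨆ ξ, component A τ ζ ξ) = Eminus A ζ := by
  ext v
  change _ ↔ Tendsto _ _ _
  constructor
  · intro hv
    rw [tendsto_iff_ultrafilter]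
    exact fun U hU => ((limit_along_ultrafilter hA hyp hgl hζ hU).2 v).2 hv
  · intro h
    obtain ⟨U, hU⟩ := Ultrafilter.exists_le (approach ζ)
    exact ((limit_along_ultrafilter hA hyp hgl hζ hU).2 v).1 (h.mono_left hU)

lemma eventually_finrank_stableSubspace : ∀ᶠ w in approach ζ,
    Module.finrank ℂ (stableSubspace A w.1 w.2) = Module.finrank ℂ (Eminus A ζ) := by
  rw [← iSup_component_eq_Eminus hA hyp hgl hζ, Filter.Eventually, mem_iff_ultrafilter]
  exact fun U hU => (limit_along_ultrafilter hA hyp hgl hζ hU).1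

omit hA hyp hgl hζ in
lemma biSup_stablePhases_component :
    (⨆ ξ ∈ stablePhases A τ ζ, component A τ ζ ξ) = ⨆ ξ, component A τ ζ ξ := by
  refine le_antisymm (iSup₂_le fun ξ _ => le_iSup (component A τ ζ) ξ) (iSup_le fun ξ => ?_)
  by_cases hξ : ξ ∈ stablePhases A τ ζ
  · exact le_iSup₂_of_le ξ hξ le_rfl
  · rw [component_of_notMem hξ]
    exact bot_le

end

end Limit

/-! ### Separation of the stable phases near a real frequency -/

section Separation

open Polynomial

variable {n N : ℕ} {A : Fin (n + 1) → Matrix (Fin N) (Fin N) ℝ}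
  {τ : Fin N → (Fin n → ℝ) × ℝ → ℝ}

lemma continuous_cfreq : Continuous (cfreq : ℝ × (Fin n → ℝ) → ℂ × (Fin n → ℝ)) := by
  unfold cfreq
  fun_prop

lemma eventually_eventually_approach {ζ₀ : ℝ × (Fin n → ℝ)} {p : ℂ × (Fin n → ℝ) → Prop}
    (h : ∀ᶠ w in approach ζ₀, p w) : ∀ᶠ ζ in 𝓝 ζ₀, ∀ᶠ w in approach ζ, p w := by
  obtain ⟨u, hu, hmem, hsub⟩ := mem_nhdsWithin.1 h
  have h1 : ∀ᶠ ζ in 𝓝 ζ₀, cfreq ζ ∈ u :=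
    continuous_cfreq.continuousAt.eventually (hu.mem_nhds hmem)
  filter_upwards [h1] with ζ hζ
  exact mem_nhdsWithin.2 ⟨u, hu, hζ, hsub⟩

lemma exists_root_of_one_le_nearCount {w : ℂ × (Fin n → ℝ)} {r : Fin N → ℂ}
    (hr : (bdryMatrix A w.1 w.2).charpoly = ∏ i, (X - C (r i))) {z : ℂ} {ε : ℝ}
    (h : 1 ≤ nearCount A w z ε) : ∃ i, (r i).re < 0 ∧ dist (r i) z < ε := by
  rw [nearCount_eq_card hr] at h
  obtain ⟨i, hi⟩ := Finset.card_pos.1 h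
  exact ⟨i, (Finset.mem_filter.1 hi).2⟩

variable (hA : IsUnit (A (Fin.last n))) (hyp : StrictlyHyperbolic A τ)
  (hgl : ∀ (k : Fin N) (η : Fin n → ℝ) (ξ : ℝ), (η, ξ) ≠ 0 →
    normalDeriv τ k η ξ = 0 → normalDeriv₂ τ k η ξ ≠ 0)
include hA hyp hgl

lemma eventually_one_le_nearCount {ζ : ℝ × (Fin n → ℝ)} (hζ : ζ ≠ 0) {ξ : ℂ}
    (hξ : ξ ∈ stablePhases A τ ζ) :
    ∀ᶠ ε : ℝ in 𝓝[>] 0, ∀ᶠ w in approach ζ, 1 ≤ nearCount A w (Complex.I * ξ) ε := by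
  classical
  refine eventually_nearCount (q := fun m => 1 ≤ m) fun U r r₀ S hU hlim hS => ?_
  rcases hξ with hξ | hξ
  · obtain ⟨h0, him, hst⟩ := (mem_glancing_union_incoming_iff hA hyp hζ ξ).1 hξ
    rw [eq_ofReal_re him] at h0 ⊢
    rw [hlim.card_real_phase hU hA hyp hgl hζ hS h0, if_pos hst]
  · obtain ⟨h0, him⟩ := (mem_elliptic_iff hA ζ ξ).1 hξ
    obtain ⟨i, hi⟩ := (hlim.isRoot_iff hA ξ).1 h0
    refine Finset.card_pos.2 ⟨i, Finset.mem_filter.2 ⟨hlim.mem_of_re_neg hS ?_, hi⟩⟩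
    rw [hi]
    simpa using him

/-- Close to a real phase of `ζ₀`, the frequencies near `ζ₀` have at most one stable phase. This is
where the order two of the glancing points is used: a double real eigenvalue does not split into
several stable ones. -/
lemma exists_stablePhases_unique {ζ₀ : ℝ × (Fin n → ℝ)} (hζ₀ : ζ₀ ≠ 0) {x : ℝ}
    (hx : val (symbolPoly A) (cfreq ζ₀) x = 0) :
    ∃ ε > 0, ∀ᶠ ζ in 𝓝 ζ₀, ∀ ξ₁ ∈ stablePhases A τ ζ, ∀ ξ₂ ∈ stablePhases A τ ζ,
      dist (Complex.I * ξ₁) (Complex.I * x) < ε → dist (Complex.I * ξ₂) (Complex.I * x) < ε →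
      ξ₁ = ξ₂ := by
  classical
  have h1 : ∀ᶠ ε : ℝ in 𝓝[>] 0, ∀ᶠ w in approach ζ₀, nearCount A w (Complex.I * x) ε ≤ 1 :=
    eventually_nearCount (q := fun m => m ≤ 1) fun U r r₀ S hU hlim hS => by
      rw [hlim.card_real_phase hU hA hyp hgl hζ₀ hS hx]
      split_ifs <;> simp
  obtain ⟨ε, h2, hε⟩ := (h1.and self_mem_nhdsWithin).exists
  refine ⟨ε, hε, ?_⟩
  filter_upwards [eventually_eventually_approach h2, isOpen_ne.mem_nhds hζ₀] with ζ hζ hne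
  intro ξ₁ hξ₁ ξ₂ hξ₂ hd₁ hd₂
  by_contra hcon
  have hpos : 0 < dist (Complex.I * ξ₁) (Complex.I * ξ₂) :=
    dist_pos.2 fun h => hcon (mul_left_cancel₀ Complex.I_ne_zero h)
  have hδ : 0 < min (min (ε - dist (Complex.I * ξ₁) (Complex.I * x))
      (ε - dist (Complex.I * ξ₂) (Complex.I * x)))
      (dist (Complex.I * ξ₁) (Complex.I * ξ₂) / 2) :=
    lt_min (lt_min (sub_pos.2 hd₁) (sub_pos.2 hd₂)) (half_pos hpos)
  obtain ⟨δ, ⟨h3, h4⟩, h5⟩ := ((eventually_one_le_nearCount hA hyp hgl hne hξ₁).and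
    (eventually_one_le_nearCount hA hyp hgl hne hξ₂) |>.and (Ioo_mem_nhdsGT hδ)).exists
  obtain ⟨w, ⟨h6, h7⟩, h8⟩ := ((h3.and h4).and hζ).exists
  obtain ⟨r, hr⟩ := exists_charpoly_eq_prod (bdryMatrix A w.1 w.2)
  obtain ⟨i, hi, hi'⟩ := exists_root_of_one_le_nearCount hr h6
  obtain ⟨j, hj, hj'⟩ := exists_root_of_one_le_nearCount hr h7
  have hb := h5.2
  simp only [lt_min_iff] at hb
  rw [nearCount_eq_card hr] at h8
  refine absurd h8 (not_le.2 (Finset.one_lt_card.2 ⟨i, ?_, j, ?_, ?_⟩))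
  · simp only [Finset.mem_filter, Finset.mem_univ, true_and]
    exact ⟨hi, (dist_triangle _ (Complex.I * ξ₁) _).trans_lt (by linarith [hb.1.1])⟩
  · simp only [Finset.mem_filter, Finset.mem_univ, true_and]
    exact ⟨hj, (dist_triangle _ (Complex.I * ξ₂) _).trans_lt (by linarith [hb.1.2])⟩
  · rintro rfl
    have := dist_triangle_left (Complex.I * ξ₁) (Complex.I * ξ₂) (r i)
    linarith [hb.2]

end Separation

/-! ### Homogeneity -/

section Homogeneity

variable {n N : ℕ} {A : Fin (n + 1) → Matrix (Fin N) (Fin N) ℝ}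
  {τ : Fin N → (Fin n → ℝ) × ℝ → ℝ}

lemma val_symbolPoly_smul (s : ℝ) (w : ℂ × (Fin n → ℝ)) (ξ : ℂ) :
    val (symbolPoly A) (s * w.1, s • w.2) (s * ξ) = (s : ℂ) ^ N * val (symbolPoly A) w ξ := by
  have h : csymbol A (s * w.1, s • w.2) (s * ξ) = (s : ℂ) • csymbol A w ξ := by
    simp only [csymbol, smul_add, Finset.smul_sum, smul_smul, Pi.smul_apply, smul_eq_mul,
      Complex.ofReal_mul]
  rw [val_symbolPoly, val_symbolPoly, h, Matrix.det_smul, Fintype.card_fin]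

lemma val_dξ_smul (s : ℝ) (w : ℂ × (Fin n → ℝ)) (ξ : ℂ) :
    val (dξ (symbolPoly A)) (s * w.1, s • w.2) (s * ξ) * s =
      (s : ℂ) ^ N * val (dξ (symbolPoly A)) w ξ := by
  have hs : HasDerivAt (fun ξ : ℂ => (s : ℂ) * ξ) s ξ := by
    simpa using (hasDerivAt_id ξ).const_mul (s : ℂ)
  have h1 := (hasDerivAt_val (symbolPoly A) (s * w.1, s • w.2) (s * ξ)).comp ξ hs
  have h2 := (hasDerivAt_val (symbolPoly A) w ξ).const_mul ((s : ℂ) ^ N)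
  simp only [← val_symbolPoly_smul] at h2
  exact h1.unique h2

lemma val_dσ_smul (s : ℝ) (w : ℂ × (Fin n → ℝ)) (ξ : ℂ) :
    val (dσ (symbolPoly A)) (s * w.1, s • w.2) (s * ξ) * s =
      (s : ℂ) ^ N * val (dσ (symbolPoly A)) w ξ := by
  have hs : HasDerivAt (fun σ : ℂ => (s : ℂ) * σ) s w.1 := by
    simpa using (hasDerivAt_id w.1).const_mul (s : ℂ)
  have h1 := (hasDerivAt_val_fst (symbolPoly A) (s * w.1, s • w.2) (s * ξ)).comp w.1 hs
  have h2 := (hasDerivAt_val_fst (symbolPoly A) w ξ).const_mul ((s : ℂ) ^ N)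
  have h3 : ∀ σ : ℂ, (s : ℂ) ^ N * val (symbolPoly A) (σ, w.2) ξ =
      val (symbolPoly A) (s * σ, s • w.2) (s * ξ) := fun σ =>
    (val_symbolPoly_smul s (σ, w.2) ξ).symm
  simp only [h3] at h2
  exact h1.unique h2

lemma cfreq_smul (s : ℝ) (ζ : ℝ × (Fin n → ℝ)) :
    cfreq (s • ζ) = (s * (cfreq ζ).1, s • (cfreq ζ).2) := by
  simp [cfreq]

lemma signStable_smul {s : ℝ} (hs : 0 < s) (ζ : ℝ × (Fin n → ℝ)) (x : ℝ) :
    SignStable A (s • ζ) (s * x) ↔ SignStable A ζ x := by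
  have h1 := congrArg Complex.re (val_dξ_smul (A := A) s (cfreq ζ) x)
  have h2 := congrArg Complex.re (val_dσ_smul (A := A) s (cfreq ζ) x)
  rw [← cfreq_smul, ← Complex.ofReal_pow, Complex.re_mul_ofReal, Complex.re_ofReal_mul,
    ← Complex.ofReal_mul] at h1 h2
  rw [SignStable, SignStable]
  set a' := (val (dσ (symbolPoly A)) (cfreq (s • ζ)) ((s * x : ℝ) : ℂ)).re
  set b' := (val (dξ (symbolPoly A)) (cfreq (s • ζ)) ((s * x : ℝ) : ℂ)).re
  set a := (val (dσ (symbolPoly A)) (cfreq ζ) x).re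
  set b := (val (dξ (symbolPoly A)) (cfreq ζ) x).re
  have h3 : (s * s) * (a' * b') = (s ^ N * s ^ N) * (a * b) := by
    linear_combination (b' * s) * h2 + (s ^ N * a) * h1
  rw [← mul_nonneg_iff_of_pos_left (mul_pos hs hs), h3,
    mul_nonneg_iff_of_pos_left (by positivity)]

lemma bdryOp_smul (s : ℝ) (ζ : ℝ × (Fin n → ℝ)) :
    bdryOp A ((s • ζ).1 : ℂ) (s • ζ).2 = (s : ℂ) • bdryOp A ζ.1 ζ.2 := by
  rw [bdryOp, bdryOp, ← map_smul]
  congr 1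
  simp only [bdryMatrix, Prod.smul_fst, Prod.smul_snd, smul_eq_mul, Pi.smul_apply,
    Complex.ofReal_mul]
  have h : ((s : ℂ) * ζ.1) • (1 : Matrix (Fin N) (Fin N) ℂ) +
      ∑ i : Fin n, ((s : ℂ) * ζ.2 i) • (A i.castSucc).map Complex.ofReal =
      (s : ℂ) • ((ζ.1 : ℂ) • 1 + ∑ i : Fin n, (ζ.2 i : ℂ) • (A i.castSucc).map Complex.ofReal) := by
    simp only [smul_add, Finset.smul_sum, smul_smul]
  rw [h, Matrix.mul_smul, smul_comm]

lemma val_symbolPoly_smul_eq_zero_iff {s : ℝ} (hs : 0 < s) (ζ : ℝ × (Fin n → ℝ)) (ξ : ℂ) :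
    val (symbolPoly A) (cfreq (s • ζ)) (s * ξ) = 0 ↔ val (symbolPoly A) (cfreq ζ) ξ = 0 := by
  rw [cfreq_smul, val_symbolPoly_smul, mul_eq_zero,
    or_iff_right (pow_ne_zero _ (Complex.ofReal_ne_zero.2 hs.ne'))]

lemma smul_mem_elliptic_iff (hA : IsUnit (A (Fin.last n))) {s : ℝ} (hs : 0 < s)
    (ζ : ℝ × (Fin n → ℝ)) (ξ : ℂ) : (s : ℂ) * ξ ∈ elliptic A (s • ζ) ↔ ξ ∈ elliptic A ζ := by
  rw [mem_elliptic_iff hA, mem_elliptic_iff hA, val_symbolPoly_smul_eq_zero_iff hs,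
    Complex.im_ofReal_mul, mul_pos_iff_of_pos_left hs]

lemma smul_mem_real_iff (hA : IsUnit (A (Fin.last n))) (hyp : StrictlyHyperbolic A τ) {s : ℝ}
    (hs : 0 < s) {ζ : ℝ × (Fin n → ℝ)} (hζ : ζ ≠ 0) (ξ : ℂ) :
    (s : ℂ) * ξ ∈ glancing A τ (s • ζ) ∪ incoming A τ (s • ζ) ↔
      ξ ∈ glancing A τ ζ ∪ incoming A τ ζ := by
  rw [mem_glancing_union_incoming_iff hA hyp (smul_ne_zero hs.ne' hζ),
    mem_glancing_union_incoming_iff hA hyp hζ, val_symbolPoly_smul_eq_zero_iff hs,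
    Complex.im_ofReal_mul, Complex.re_ofReal_mul, signStable_smul hs, mul_eq_zero,
    or_iff_right hs.ne']

lemma smul_mem_stablePhases_iff (hA : IsUnit (A (Fin.last n))) (hyp : StrictlyHyperbolic A τ)
    {s : ℝ} (hs : 0 < s) {ζ : ℝ × (Fin n → ℝ)} (hζ : ζ ≠ 0) (ξ : ℂ) :
    (s : ℂ) * ξ ∈ stablePhases A τ (s • ζ) ↔ ξ ∈ stablePhases A τ ζ :=
  or_congr (smul_mem_real_iff hA hyp hs hζ ξ) (smul_mem_elliptic_iff hA hs ζ ξ)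

lemma component_smul (hA : IsUnit (A (Fin.last n))) (hyp : StrictlyHyperbolic A τ)
    (hgl : ∀ (k : Fin N) (η : Fin n → ℝ) (ξ : ℝ), (η, ξ) ≠ 0 →
      normalDeriv τ k η ξ = 0 → normalDeriv₂ τ k η ξ ≠ 0)
    {s : ℝ} (hs : 0 < s) {ζ : ℝ × (Fin n → ℝ)} (hζ : ζ ≠ 0) (ξ : ℂ) :
    component A τ (s • ζ) (s * ξ) = component A τ ζ ξ := by
  have hs' : (s : ℂ) ≠ 0 := Complex.ofReal_ne_zero.2 hs.ne'
  have hsub : bdryOp A ((s • ζ).1 : ℂ) (s • ζ).2 - (Complex.I * (s * ξ)) • 1 =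
      (s : ℂ) • (bdryOp A ζ.1 ζ.2 - (Complex.I * ξ) • 1) := by
    rw [bdryOp_smul, smul_sub, smul_smul, mul_left_comm]
  by_cases he : ξ ∈ elliptic A ζ
  · rw [component_of_elliptic he,
      component_of_elliptic ((smul_mem_elliptic_iff hA hs ζ ξ).2 he)]
    ext v
    simp only [Module.End.mem_maxGenEigenspace, hsub, smul_pow, LinearMap.smul_apply, smul_eq_zero,
      pow_eq_zero_iff', hs', false_and, false_or]
  · by_cases hr : ξ ∈ glancing A τ ζ ∪ incoming A τ ζ
    · rw [component_of_real hA hyp hgl hζ hr, component_of_real hA hyp hgl (smul_ne_zero hs.ne' hζ)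
        ((smul_mem_real_iff hA hyp hs hζ ξ).2 hr), Algebra.algebraMap_eq_smul_one,
        Algebra.algebraMap_eq_smul_one, hsub]
      exact LinearMap.ker_smul _ _ hs'
    · have h1 : ξ ∉ stablePhases A τ ζ := fun h => h.elim hr he
      rw [component_of_notMem h1,
        component_of_notMem (mt (smul_mem_stablePhases_iff hA hyp hs hζ ξ).1 h1)]

end Homogeneity

/-! ### Uniform bounds -/

section Bounds

open Polynomial

variable {n N : ℕ} {A : Fin (n + 1) → Matrix (Fin N) (Fin N) ℝ}
  {τ : Fin N → (Fin n → ℝ) × ℝ → ℝ}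

/-- The sum of the components over a set of phases. -/
noncomputable def partSum (A : Fin (n + 1) → Matrix (Fin N) (Fin N) ℝ)
    (τ : Fin N → (Fin n → ℝ) × ℝ → ℝ) (ζ : ℝ × (Fin n → ℝ)) (J : Set ℂ) :
    Submodule ℂ (State N) :=
  ⨆ ξ ∈ J, component A τ ζ ξ

/-- The sets of phases whose components are to be split off: a single glancing or incoming phase, or
all the elliptic ones. -/
def IsPart (A : Fin (n + 1) → Matrix (Fin N) (Fin N) ℝ)
    (τ : Fin N → (Fin n → ℝ) × ℝ → ℝ) (ζ : ℝ × (Fin n → ℝ)) (J : Set ℂ) : Prop :=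
  J = elliptic A ζ ∨ ∃ ξ ∈ glancing A τ ζ ∪ incoming A τ ζ, J = {ξ}

lemma IsPart.subset {ζ : ℝ × (Fin n → ℝ)} {J : Set ℂ} (hJ : IsPart A τ ζ J) :
    J ⊆ stablePhases A τ ζ := by
  rcases hJ with rfl | ⟨ξ, hξ, rfl⟩
  · exact Set.subset_union_right
  · exact Set.singleton_subset_iff.2 (Or.inl hξ)

lemma partSum_le_ker {ι : Type*} [Fintype ι] {ζ : ℝ × (Fin n → ℝ)} {r : ι → ℂ}
    (hA : IsUnit (A (Fin.last n))) (hyp : StrictlyHyperbolic A τ)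
    (hgl : ∀ (k : Fin N) (η : Fin n → ℝ) (ξ : ℝ), (η, ξ) ≠ 0 →
      normalDeriv τ k η ξ = 0 → normalDeriv₂ τ k η ξ ≠ 0) (hζ : ζ ≠ 0)
    (hr : (bdryOp A ζ.1 ζ.2).charpoly = ∏ i, (X - C (r i))) {J : Set ℂ} {G : Finset ι}
    (h : ∀ i, -Complex.I * r i ∈ J → i ∈ G) :
    partSum A τ ζ J ≤ LinearMap.ker (aeval (bdryOp A ζ.1 ζ.2) (∏ i ∈ G, (X - C (r i)))) := by
  refine iSup₂_le fun ξ hξ => (component_le_maxGenEigenspace hA hyp hgl hζ ξ).trans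
    (maxGenEigenspace_le_ker_aeval_prod hr G fun i hi => h i ?_)
  rwa [hi, neg_I_mul_I_mul]

variable (hA : IsUnit (A (Fin.last n))) (hyp : StrictlyHyperbolic A τ)
  (hgl : ∀ (k : Fin N) (η : Fin n → ℝ) (ξ : ℝ), (η, ξ) ≠ 0 →
    normalDeriv τ k η ξ = 0 → normalDeriv₂ τ k η ξ ≠ 0)
include hA hyp hgl

/-- Along a convergent family of real frequencies, a part and its complement do not share a group of
roots with a common limit. -/
lemma separation_along_ultrafilter (V : Ultrafilter ℕ) {ζ : ℕ → ℝ × (Fin n → ℝ)}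
    {ζ₀ : ℝ × (Fin n → ℝ)} (hζ : Tendsto ζ V (𝓝 ζ₀)) (hζ₀ : ζ₀ ≠ 0) {J : ℕ → Set ℂ}
    (hJ : ∀ m, IsPart A τ (ζ m) (J m)) {r : ℂ × (Fin n → ℝ) → Fin N → ℂ} {r₀ : Fin N → ℂ}
    (hlim : RootLimit A ζ₀ (V.map fun m => cfreq (ζ m)) r r₀) {i j : Fin N} (hij : r₀ i = r₀ j)
    (hi : ∀ᶠ m in (V : Filter ℕ),
      -Complex.I * r (cfreq (ζ m)) i ∈ stablePhases A τ (ζ m) \ J m)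
    (hj : ∀ᶠ m in (V : Filter ℕ), -Complex.I * r (cfreq (ζ m)) j ∈ J m) : False := by
  have hr : ∀ l, Tendsto (fun m => r (cfreq (ζ m)) l) V (𝓝 (r₀ l)) := fun l =>
    tendsto_pi_nhds.1 ((show Tendsto r _ _ from hlim.tendsto).comp tendsto_map) l
  have hre : ∀ l, Tendsto (fun m => (r (cfreq (ζ m)) l).re) V (𝓝 (r₀ l).re) := fun l =>
    (Complex.continuous_re.tendsto _).comp (hr l)
  have hne : ∀ᶠ m in (V : Filter ℕ), ζ m ≠ 0 := hζ.eventually (isOpen_ne.mem_nhds hζ₀)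
  rcases lt_trichotomy (r₀ j).re 0 with h | h | h
  · -- both roots are elliptic, so that the part is the elliptic one and contains both
    obtain ⟨m, h1, h2, h3, h4, h5⟩ := (hi.and (hj.and (hne.and
      (((hre i).eventually (gt_mem_nhds (by rwa [hij]))).and
        ((hre j).eventually (gt_mem_nhds h)))))).exists
    have hJm : J m = elliptic A (ζ m) := by
      refine (hJ m).resolve_right ?_
      rintro ⟨ξ, hξ, hJξ⟩
      rw [hJξ, Set.mem_singleton_iff] at h2
      have := ((mem_glancing_union_incoming_iff hA hyp h3 ξ).1 hξ).2.1
      rw [← h2, im_neg_I_mul] at this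
      linarith
    refine h1.2 ?_
    rw [hJm]
    refine h1.1.resolve_left fun hcon => ?_
    have := ((mem_glancing_union_incoming_iff hA hyp h3 _).1 hcon).2.1
    rw [im_neg_I_mul] at this
    linarith
  · -- both roots are stable phases close to the same real phase
    have hx : r₀ j = Complex.I * ((r₀ j).im : ℝ) := Complex.ext (by simp [h]) (by simp)
    have hroot : val (symbolPoly A) (cfreq ζ₀) ((r₀ j).im : ℝ) = 0 :=
      (hlim.isRoot_iff hA _).2 ⟨j, hx⟩
    obtain ⟨ε, hε, huniq⟩ := exists_stablePhases_unique hA hyp hgl hζ₀ hroot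
    have hd : ∀ l, r₀ l = r₀ j → ∀ᶠ m in (V : Filter ℕ),
        dist (Complex.I * (-Complex.I * r (cfreq (ζ m)) l)) (Complex.I * ((r₀ j).im : ℝ)) < ε := by
      intro l hl
      have h1 := hr l
      rw [hl, hx] at h1
      filter_upwards [h1 (Metric.ball_mem_nhds _ hε)] with m hm
      rw [I_mul_neg_I_mul]
      exact hm
    obtain ⟨m, h1, h2, h3, h4, h5⟩ := (hi.and (hj.and ((hζ.eventually huniq).and
      ((hd i hij).and (hd j rfl))))).exists
    have heq := h3 _ h1.1 _ ((hJ m).subset h2) h4 h5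
    exact h1.2 (heq ▸ h2)
  · -- stable phases have a nonnegative imaginary part
    obtain ⟨m, h1, h2, h3⟩ := (hj.and (hne.and ((hre j).eventually (lt_mem_nhds h)))).exists
    have h4 := im_neg_I_mul (r (cfreq (ζ m)) j)
    rcases (hJ m).subset h1 with h5 | h5
    · have := ((mem_glancing_union_incoming_iff hA hyp h2 _).1 h5).2.1
      linarith
    · have := h5.2
      linarith

/-- Compactness: on the unit sphere of frequencies, a part and the sum of the other components stay
uniformly transverse. -/
lemma exists_bound_on_sphere : ∃ C : ℝ, ∀ ζ : ℝ × (Fin n → ℝ), ‖ζ‖ = 1 → ∀ J, IsPart A τ ζ J →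
    ∀ u ∈ partSum A τ ζ J, ∀ v ∈ partSum A τ ζ (stablePhases A τ ζ \ J), ‖u‖ ≤ C * ‖u + v‖ := by
  classical
  by_contra hcon
  push Not at hcon
  have hcon' : ∀ m : ℕ, ∃ ζ : ℝ × (Fin n → ℝ), ‖ζ‖ = 1 ∧ ∃ J, IsPart A τ ζ J ∧
      ∃ u ∈ partSum A τ ζ J, ∃ v ∈ partSum A τ ζ (stablePhases A τ ζ \ J),
        ‖u‖ = 1 ∧ ‖u + v‖ < 1 / ((m : ℝ) + 1) := by
    intro m
    obtain ⟨ζ, h1, J, h2, u, hu, v, hv, h3⟩ := hcon ((m : ℝ) + 1)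
    have hm : (0 : ℝ) < (m : ℝ) + 1 := by positivity
    have hu0 : 0 < ‖u‖ := lt_of_le_of_lt (by positivity) h3
    refine ⟨ζ, h1, J, h2, ((‖u‖⁻¹ : ℝ) : ℂ) • u, Submodule.smul_mem _ _ hu,
      ((‖u‖⁻¹ : ℝ) : ℂ) • v, Submodule.smul_mem _ _ hv, ?_, ?_⟩
    · rw [norm_smul, Complex.norm_real, norm_inv, norm_norm, inv_mul_cancel₀ hu0.ne']
    · rw [← smul_add, norm_smul, Complex.norm_real, norm_inv, norm_norm, inv_mul_lt_iff₀ hu0,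
        mul_one_div, lt_div_iff₀ hm]
      linarith
  choose ζ hζ J hJ u hu v hv hu1 huv using hcon'
  set V : Ultrafilter ℕ := hyperfilter ℕ
  have hV : (V : Filter ℕ) ≤ atTop := by
    rw [← Nat.cofinite_eq_atTop]
    exact hyperfilter_le_cofinite
  obtain ⟨ζ₀, hζ₀, hlimζ⟩ := (isCompact_sphere (0 : ℝ × (Fin n → ℝ)) 1).ultrafilter_le_nhds
    (V.map ζ) (le_principal_iff.2 (Eventually.of_forall (f := (V : Filter ℕ)) fun m => by
      simpa using hζ m))
  have hlimζ' : Tendsto ζ V (𝓝 ζ₀) := hlimζ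
  have hζ₀' : ζ₀ ≠ 0 := by
    rintro rfl
    simp at hζ₀
  have hne : ∀ m, ζ m ≠ 0 := fun m h => by
    have := hζ m
    simp [h] at this
  obtain ⟨u₀, hu₀, hlimu⟩ := (isCompact_sphere (0 : State N) 1).ultrafilter_le_nhds
    (V.map u) (le_principal_iff.2 (Eventually.of_forall (f := (V : Filter ℕ)) fun m => by
      simpa using hu1 m))
  have hlimu' : Tendsto u V (𝓝 u₀) := hlimu
  have hlimuv : Tendsto (fun m => u m + v m) V (𝓝 0) :=
    squeeze_zero_norm (fun m => (huv m).le) (tendsto_one_div_add_atTop_nhds_zero_nat.mono_left hV)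
  have hlimv : Tendsto v V (𝓝 (-u₀)) := by
    have := hlimuv.sub hlimu'
    simpa using this
  have hw : Tendsto (fun m => cfreq (ζ m)) V (𝓝 (cfreq ζ₀)) :=
    (continuous_cfreq.tendsto ζ₀).comp hlimζ'
  obtain ⟨r, r₀, hlim⟩ := exists_rootLimit (A := A) ζ₀ (V.map fun m => cfreq (ζ m)) hw
  have hr : Tendsto (fun m => r (cfreq (ζ m))) V (𝓝 r₀) :=
    (show Tendsto r _ _ from hlim.tendsto).comp tendsto_map
  have hcp : ∀ m, (bdryOp A (ζ m).1 (ζ m).2).charpoly = ∏ i, (X - C (r (cfreq (ζ m)) i)) :=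
    fun m => hlim.charpoly_bdryOp (cfreq (ζ m))
  -- the groups of roots with a member in the part
  set G : Finset (Fin N) := Finset.univ.filter fun i => ∃ j, r₀ i = r₀ j ∧
    ∀ᶠ m in (V : Filter ℕ), -Complex.I * r (cfreq (ζ m)) j ∈ J m with hG
  have hin : ∀ᶠ m in (V : Filter ℕ), ∀ i, -Complex.I * r (cfreq (ζ m)) i ∈ J m → i ∈ G := by
    rw [eventually_all]
    intro i
    rw [Ultrafilter.eventually_imp]
    intro h
    exact Eventually.of_forall fun _ => Finset.mem_filter.2 ⟨Finset.mem_univ i, i, rfl, h⟩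
  have hout : ∀ᶠ m in (V : Filter ℕ), ∀ i,
      -Complex.I * r (cfreq (ζ m)) i ∈ stablePhases A τ (ζ m) \ J m → i ∈ Gᶜ := by
    rw [eventually_all]
    intro i
    rw [Ultrafilter.eventually_imp]
    intro h
    refine Eventually.of_forall fun _ => Finset.mem_compl.2 fun hi => ?_
    obtain ⟨-, j, hij, hj⟩ := Finset.mem_filter.1 hi
    exact separation_along_ultrafilter hA hyp hgl V hlimζ' hζ₀' hJ hlim hij h hj
  have hT : Tendsto (fun m => opCLM (bdryMatrix A (cfreq (ζ m)).1 (cfreq (ζ m)).2)) V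
      (𝓝 (opCLM (bdryMatrix A (cfreq ζ₀).1 (cfreq ζ₀).2))) :=
    ((continuous_opCLM.comp continuous_bdryMatrix).tendsto (cfreq ζ₀)).comp hw
  have hker : ∀ (H : Finset (Fin N)) {x : ℕ → State N} {x₀ : State N}, Tendsto x V (𝓝 x₀) →
      (∀ᶠ m in (V : Filter ℕ), x m ∈ LinearMap.ker (aeval (bdryOp A (ζ m).1 (ζ m).2)
        (∏ i ∈ H, (X - C (r (cfreq (ζ m)) i))))) →
      x₀ ∈ LinearMap.ker (aeval (opCLM (bdryMatrix A (cfreq ζ₀).1 (cfreq ζ₀).2) :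
        Module.End ℂ (State N)) (∏ i ∈ H, (X - C (r₀ i)))) := by
    intro H x x₀ hx hmem
    have h1 := tendsto_aeval_prod_apply hT hr H hx
    refine tendsto_nhds_unique h1 (tendsto_const_nhds.congr' ?_)
    filter_upwards [hmem] with m hm
    rw [coe_opCLM]
    exact (LinearMap.mem_ker.1 hm).symm
  have hk₁ := hker G hlimu' (hin.mono fun m hm =>
    partSum_le_ker hA hyp hgl (hne m) (hcp m) hm (hu m))
  have hk₂ := hker Gᶜ hlimv (hout.mono fun m hm =>
    partSum_le_ker hA hyp hgl (hne m) (hcp m) hm (hv m))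
  have hcop : IsCoprime (∏ i ∈ G, (X - C (r₀ i))) (∏ i ∈ Gᶜ, (X - C (r₀ i))) := by
    refine IsCoprime.prod_left fun i hi => IsCoprime.prod_right fun j hj => ?_
    refine isCoprime_X_sub_C_of_isUnit_sub (sub_ne_zero.2 fun h => ?_).isUnit
    obtain ⟨-, l, hl, hl'⟩ := Finset.mem_filter.1 hi
    exact Finset.mem_compl.1 hj (Finset.mem_filter.2 ⟨Finset.mem_univ j, l, h ▸ hl, hl'⟩)
  have h0 := (disjoint_ker_aeval_of_isCoprime _ hcop).le_bot
    ⟨hk₁, (Submodule.neg_mem_iff _).1 hk₂⟩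
  rw [Submodule.mem_bot] at h0
  rw [h0] at hu₀
  simp at hu₀

lemma partSum_le_smul {s : ℝ} (hs : 0 < s) {ζ : ℝ × (Fin n → ℝ)} (hζ : ζ ≠ 0) {J K : Set ℂ}
    (h : ∀ ξ ∈ J, (s : ℂ) * ξ ∈ K) : partSum A τ ζ J ≤ partSum A τ (s • ζ) K := by
  refine iSup₂_le fun ξ hξ => ?_
  rw [← component_smul hA hyp hgl hs hζ ξ]
  exact le_iSup₂_of_le ((s : ℂ) * ξ) (h ξ hξ) le_rfl

lemma exists_uniform_bound : ∃ C : ℝ, 0 ≤ C ∧ ∀ ζ : ℝ × (Fin n → ℝ), ζ ≠ 0 → ∀ J, IsPart A τ ζ J →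
    ∀ u ∈ partSum A τ ζ J, ∀ v ∈ partSum A τ ζ (stablePhases A τ ζ \ J), ‖u‖ ≤ C * ‖u + v‖ := by
  obtain ⟨C, hC⟩ := exists_bound_on_sphere hA hyp hgl
  refine ⟨max C 0, le_max_right _ _, fun ζ hζ J hJ u hu v hv => ?_⟩
  have hs : 0 < ‖ζ‖⁻¹ := inv_pos.2 (norm_pos_iff.2 hζ)
  set s := ‖ζ‖⁻¹
  have hs' : (s : ℂ) ≠ 0 := Complex.ofReal_ne_zero.2 hs.ne'
  have h1 : ‖s • ζ‖ = 1 := by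
    rw [norm_smul, norm_inv, norm_norm, inv_mul_cancel₀ (norm_ne_zero_iff.2 hζ)]
  have hJ' : IsPart A τ (s • ζ) ((fun ξ => (s : ℂ) * ξ) '' J) := by
    rcases hJ with rfl | ⟨ξ, hξ, rfl⟩
    · left
      ext ξ
      constructor
      · rintro ⟨ξ', h, rfl⟩
        exact (smul_mem_elliptic_iff hA hs ζ ξ').2 h
      · intro h
        have h2 : (s : ℂ) * ((s : ℂ)⁻¹ * ξ) = ξ := mul_inv_cancel_left₀ hs' ξ
        refine ⟨(s : ℂ)⁻¹ * ξ, ?_, h2⟩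
        rw [← smul_mem_elliptic_iff hA hs, h2]
        exact h
    · exact Or.inr ⟨s * ξ, (smul_mem_real_iff hA hyp hs hζ ξ).2 hξ, by simp⟩
  refine (hC (s • ζ) h1 _ hJ' u ?_ v ?_).trans
    (mul_le_mul_of_nonneg_right (le_max_left _ _) (norm_nonneg _))
  · exact partSum_le_smul hA hyp hgl hs hζ (fun ξ hξ => Set.mem_image_of_mem _ hξ) hu
  · refine partSum_le_smul hA hyp hgl hs hζ (fun ξ hξ => ?_) hv
    refine ⟨(smul_mem_stablePhases_iff hA hyp hs hζ ξ).2 hξ.1, ?_⟩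
    rintro ⟨ξ', h, he⟩
    exact hξ.2 (mul_left_cancel₀ hs' he ▸ h)

omit hA hyp hgl in
lemma norm_projAlong_le {E F K : Submodule ℂ (State N)} {C : ℝ} (hC : 0 ≤ C)
    (h : ∀ u ∈ F, ∀ v ∈ K, ‖u‖ ≤ C * ‖u + v‖) : ‖projAlong E F K‖ ≤ C := by
  rw [projAlong]
  split_ifs with hc
  · refine ContinuousLinearMap.opNorm_le_bound _ hC fun e => ?_
    have h1 := Submodule.projection_apply_mem hc e
    have h2 := Submodule.sub_projection_mem hc e
    have h3 := h _ h1 _ h2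
    rw [← map_add, add_sub_cancel] at h3
    exact h3
  · exact ContinuousLinearMap.opNorm_le_bound _ hC fun e => by
      simpa using mul_nonneg hC (norm_nonneg e)

end Bounds

end HypBVP

theorem mainTheorem7 {n N : ℕ} (hn : 1 ≤ n) (hN : 1 ≤ N)
    (A : Fin (n + 1) → Matrix (Fin N) (Fin N) ℝ)
    (hAd : IsUnit (A (Fin.last n)))
    (τ : Fin N → (Fin n → ℝ) × ℝ → ℝ)
    (hyp : HypBVP.StrictlyHyperbolic A τ)
    (hglancing : ∀ (k : Fin N) (η : Fin n → ℝ) (ξ : ℝ), (η, ξ) ≠ 0 →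
      HypBVP.normalDeriv τ k η ξ = 0 → HypBVP.normalDeriv₂ τ k η ξ ≠ 0) :
    -- `E_-(ζ)` has the dimension of the nearby stable subspaces and is the direct sum of its
    -- components, so that the projectors below are the ones of this decomposition
    (∀ ζ : ℝ × (Fin n → ℝ), ζ ≠ 0 →
      (∀ᶠ w in HypBVP.approach ζ,
        Module.finrank ℂ (HypBVP.stableSubspace A w.1 w.2) =
          Module.finrank ℂ (HypBVP.Eminus A ζ)) ∧
      iSupIndep (fun ξ : HypBVP.stablePhases A τ ζ => HypBVP.component A τ ζ ξ) ∧
      (⨆ ξ ∈ HypBVP.stablePhases A τ ζ, HypBVP.component A τ ζ ξ) = HypBVP.Eminus A ζ) ∧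
    -- uniform bounds
    ∃ C : ℝ, ∀ ζ : ℝ × (Fin n → ℝ), ζ ≠ 0 →
      (∀ ξ ∈ HypBVP.glancing A τ ζ ∪ HypBVP.incoming A τ ζ,
        ‖HypBVP.projComponent A τ ζ ξ‖ ≤ C) ∧
      ‖HypBVP.projElliptic A τ ζ‖ ≤ C := by
  refine ⟨fun ζ hζ => ⟨HypBVP.eventually_finrank_stableSubspace hAd hyp hglancing hζ,
    (HypBVP.iSupIndep_component hAd hyp hglancing hζ).comp Subtype.val_injective,
    HypBVP.biSup_stablePhases_component.trans
      (HypBVP.iSup_component_eq_Eminus hAd hyp hglancing hζ)⟩, ?_⟩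
  obtain ⟨C, hC0, hC⟩ := HypBVP.exists_uniform_bound hAd hyp hglancing
  refine ⟨C, fun ζ hζ => ⟨fun ξ hξ => ?_, ?_⟩⟩
  · refine HypBVP.norm_projAlong_le hC0 fun u hu v hv =>
      hC ζ hζ {ξ} (Or.inr ⟨ξ, hξ, rfl⟩) u ?_ v hv
    simpa [HypBVP.partSum] using hu
  · refine HypBVP.norm_projAlong_le hC0 fun u hu v hv =>
      hC ζ hζ _ (Or.inl rfl) u hu v ?_
    -- no phase is both real and elliptic
    have hsub : HypBVP.glancing A τ ζ ∪ HypBVP.incoming A τ ζ ⊆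
        HypBVP.stablePhases A τ ζ \ HypBVP.elliptic A ζ := fun ξ hξ => ⟨Or.inl hξ, fun he =>
      he.2.ne' ((HypBVP.mem_glancing_union_incoming_iff hAd hyp hζ ξ).1 hξ).2.1⟩
    have hle : (⨆ ξ ∈ HypBVP.glancing A τ ζ ∪ HypBVP.incoming A τ ζ, HypBVP.component A τ ζ ξ) ≤
        HypBVP.partSum A τ ζ (HypBVP.stablePhases A τ ζ \ HypBVP.elliptic A ζ) :=
      biSup_mono hsub
    exact hle hv
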